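/- Let $n \geq 2$ and let $F_n$ be the free group on $x_1, \ldots, x_n$. Let $$\mathbb{Q}[t] = \mathbb{Q}[t_{i_1 \cdots i_l} \mid 1 \leq l \leq 3,\ 1 \leq i_1 < \cdots < i_l \leq n]$$ be the polynomial ring in $n + \binom{n}{2} + \binom{n}{3}$ indeterminates, and let $\pi_{\mathbb{Q}}$ be the $\mathbb{Q}$-algebra homomorphism from $\mathbb{Q}[t]$ to the algebra of all functions $\mathrm{Hom}(F_n, \mathrm{SL}(2,\mathbb{C})) \to \mathbb{C}$ that sends $t_{i_1 \cdots i_l}$ to the function $\rho \mapsto \mathrm{tr}\,\rho(x_{i_1} \cdots x_{i_l})$. Put $I_{\mathbb{Q}} = \mathrm{Ker}\,\pi_{\mathbb{Q}}$ and $t'_{i_1 \cdots i_l} = t_{i_1 \cdots i_l} - 2$, and let $J$ be the ideal of $\mathbb{Q}[t]/I_{\mathbb{Q}}$ generated by the classes of all the $t'_{i_1 \cdots i_l}$. For $k \geq 1$ let $\mathrm{gr}^k(J) = J^k/J^{k+1}$. Define subsets of $\mathbb{Q}[t]$ by $$T = \{ t'_i \mid 1 \leq i \leq n \} \cup \{ t'_{ij}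 \mid 1 \leq i < j \leq n \} \cup \{ t'_{ijk} \mid 1 \leq i < j < k \leq n \}$$ and $$\begin{aligned} S = {} & \{ t'_i t'_j \mid 1 \leq i \leq j \leq n \} \cup \{ t'_i t'_{ab} \mid 1 \leq i \leq n,\ 1 \leq a < b \leq n \} \\ & \cup \{ t'_i t'_{abc} \mid 1 \leq i \leq n,\ 1 \leq a < b < c \leq n \} \\ & \cup \{ t'_{ij} t'_{ab} \mid 1 \leq i < j \leq n,\ 1 \leq a < b \leq n,\ (i,j) \leq (a,b) \} \\ & \cup \{ t'_{ab} t'_{abc},\ t'_{ac} t'_{abc},\ t'_{bc} t'_{abc} \mid 1 \leq a < b < c \leq n \} \\ & \cup \{ t'_{ia} t'_{abc},\ t'_{ib} t'_{abc},\ t'_{ic} t'_{abc},\ t'_{ia} t'_{ibc},\ t'_{ab} t'_{iac},\ t'_{ab} t'_{ibc},\ t'_{ac} t'_{ibc},\ t'_{ib} t'_{iac} \mid 1 \leq i < a < b < c \leq n \} \\ & \cup \{ t'_{ja} t'_{ibc},\ t'_{jb} t'_{iac},\ t'_{jc} t'_{iab},\ t'_{ab} t'_{ijc},\ t'_{ac}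 t'_{ijb},\ t'_{bc} t'_{ija} \mid 1 \leq i < j < a < b < c \leq n \}, \end{aligned}$$ where pairs are compared lexicographically. Let $J_0$ be the ideal of $\mathbb{Q}[t]$ generated by $T$. Then: 1. $I_{\mathbb{Q}} \subset J_0^2$; 2. the classes of the elements of $T$ lie in $J$ and form a $\mathbb{Q}$-basis of $\mathrm{gr}^1(J)$ (distinct elements of $T$ having distinct classes); 3. the classes of the elements of $S$ lie in $J^2$ and form a $\mathbb{Q}$-basis of $\mathrm{gr}^2(J)$ (distinct elements of $S$ having distinct classes). -/

import Mathlib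

namespace Fricke

open Matrix

/-- Index set of the indeterminates `t_i`, `t_{ij}` (`i < j`), `t_{ijk}` (`i < j < k`). -/
inductive Index (n : ℕ) : Type
  | one (i : Fin n) : Index n
  | two (i j : Fin n) (hij : i < j) : Index n
  | three (i j k : Fin n) (hij : i < j) (hjk : j < k) : Index n

/-- The product `x_{i_1} ⋯ x_{i_l}` attached to an index `i_1 < ⋯ < i_l`. -/
def Index.word {n : ℕ} {G : Type*} [Group G] (x : Fin n → G) : Index n → G
  | .one i => x i
  | .two i j _ => x i * x j
  | .three i j k _ _ => x i * x j * x k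

/-- The set `R(G) = Hom(G, SL(2, ℂ))`. -/
abbrev Rep (G : Type*) [Group G] : Type _ := G →* SpecialLinearGroup (Fin 2) ℂ

/-- The Fricke character `tr g`, a complex-valued function on `R(G)`. -/
noncomputable def tr {G : Type*} [Group G] (g : G) : Rep G → ℂ :=
  fun ρ => Matrix.trace (ρ g : Matrix (Fin 2) (Fin 2) ℂ)

/-- The polynomial ring `ℚ[t]` in the `n + C(n,2) + C(n,3)` indeterminates `t_{i_1 ⋯ i_l}`. -/
abbrev Poly (n : ℕ) : Type := MvPolynomial (Index n) ℚ

/-- The homomorphism `π_ℚ` from `ℚ[t]` to the functions on `R(G)`,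
with `t_{i_1 ⋯ i_l} ↦ tr (x_{i_1} ⋯ x_{i_l})`. -/
noncomputable def piQ {n : ℕ} {G : Type*} [Group G] (x : Fin n → G) :
    Poly n →ₐ[ℚ] (Rep G → ℂ) :=
  MvPolynomial.aeval fun s => tr (s.word x)

/-- The ideal `I_ℚ = Ker π_ℚ`. -/
noncomputable def IQ {n : ℕ} {G : Type*} [Group G] (x : Fin n → G) : Ideal (Poly n) :=
  RingHom.ker (piQ x)

/-- The ring of Fricke characters `ℚ[t] / I_ℚ`. -/
abbrev FrickeRing {n : ℕ} {G : Type*} [Group G] (x : Fin n → G) : Type :=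
  Poly n ⧸ IQ x

/-- The coset of a polynomial in `ℚ[t] / I_ℚ`. -/
noncomputable abbrev cls {n : ℕ} {G : Type*} [Group G] (x : Fin n → G) (p : Poly n) :
    FrickeRing x :=
  Ideal.Quotient.mk (IQ x) p

/-- `t'_s = t_s - 2` in `ℚ[t]`. -/
noncomputable def t' {n : ℕ} (s : Index n) : Poly n := MvPolynomial.X s - 2

/-- `t'_i`. -/
noncomputable abbrev t₁ {n : ℕ} (i : Fin n) : Poly n := t' (.one i)

/-- `t'_{ij}` for `i < j`. -/
noncomputable abbrev t₂ {n : ℕ} (i j : Fin n) (hij : i < j) : Poly n := t' (.two i j hij)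

/-- `t'_{ijk}` for `i < j < k`. -/
noncomputable abbrev t₃ {n : ℕ} (i j k : Fin n) (hij : i < j) (hjk : j < k) : Poly n :=
  t' (.three i j k hij hjk)

/-- The ideal `J` of `ℚ[t] / I_ℚ` generated by the cosets of all `t'_s`. -/
noncomputable def J {n : ℕ} {G : Type*} [Group G] (x : Fin n → G) : Ideal (FrickeRing x) :=
  Ideal.span (Set.range fun s : Index n => cls x (t' s))

/-- The graded quotient `gr^k(J) = J^k / J^{k+1}`. -/
abbrev Gr {n : ℕ} {G : Type*} [Group G] (x : Fin n → G) (k : ℕ) : Type :=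
  ↥(J x ^ k) ⧸ (J x ^ (k + 1)).submoduleOf (J x ^ k)

/-- The class in `gr^k(J)` of an element of `J^k`. -/
noncomputable def grMk {n : ℕ} {G : Type*} [Group G] (x : Fin n → G) (k : ℕ)
    (a : FrickeRing x) (ha : a ∈ J x ^ k) : Gr x k :=
  Submodule.Quotient.mk ⟨a, ha⟩

/-- A set `B` of polynomials maps into `J^k`, and the family of the resulting classes, indexed
by the elements of `B`, is a `ℚ`-basis of `gr^k(J)` (so distinct elements of `B` have distinct
classes). -/
def IsGrBasis {n : ℕ} {G : Type*} [Group G] (x : Fin n → G) (k : ℕ) (B : Set (Poly n)) : Prop :=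
  ∃ b : Module.Basis B ℚ (Gr x k),
    ∀ p : B, ∃ hp : cls x (p : Poly n) ∈ J x ^ k, b p = grMk x k (cls x (p : Poly n)) hp

/-- The set `T` of all `t'_i`, `t'_{ij}`, `t'_{ijk}`. -/
def T (n : ℕ) : Set (Poly n) :=
  {p | ∃ i : Fin n, p = t₁ i} ∪
  {p | ∃ (i j : Fin n) (hij : i < j), p = t₂ i j hij} ∪
  {p | ∃ (i j k : Fin n) (hij : i < j) (hjk : j < k), p = t₃ i j k hij hjk}

/-- The ideal `J_0` of `ℚ[t]` generated by `T`. -/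
noncomputable def J₀ (n : ℕ) : Ideal (Poly n) := Ideal.span (T n)

/-- The first part of `S`. Pairs are compared lexicographically. -/
def S₁ (n : ℕ) : Set (Poly n) :=
  {p | ∃ i j : Fin n, i ≤ j ∧ p = t₁ i * t₁ j} ∪
  {p | ∃ (i a b : Fin n) (hab : a < b), p = t₁ i * t₂ a b hab} ∪
  {p | ∃ (i a b c : Fin n) (hab : a < b) (hbc : b < c), p = t₁ i * t₃ a b c hab hbc} ∪
  {p | ∃ (i j a b : Fin n) (hij : i < j) (hab : a < b),
      toLex (i, j) ≤ toLex (a, b) ∧ p = t₂ i j hij * t₂ a b hab}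

/-- The second part of `S`. -/
def S₂ (n : ℕ) : Set (Poly n) :=
  {p | ∃ (a b c : Fin n) (hab : a < b) (hbc : b < c),
      p = t₂ a b hab * t₃ a b c hab hbc ∨
      p = t₂ a c (hab.trans hbc) * t₃ a b c hab hbc ∨
      p = t₂ b c hbc * t₃ a b c hab hbc} ∪
  {p | ∃ (i a b c : Fin n) (hia : i < a) (hab : a < b) (hbc : b < c),
      p = t₂ i a hia * t₃ a b c hab hbc ∨
      p = t₂ i b (hia.trans hab) * t₃ a b c hab hbc ∨
      p = t₂ i c (hia.trans (hab.trans hbc)) * t₃ a b c hab hbc ∨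
      p = t₂ i a hia * t₃ i b c (hia.trans hab) hbc ∨
      p = t₂ a b hab * t₃ i a c hia (hab.trans hbc) ∨
      p = t₂ a b hab * t₃ i b c (hia.trans hab) hbc ∨
      p = t₂ a c (hab.trans hbc) * t₃ i b c (hia.trans hab) hbc ∨
      p = t₂ i b (hia.trans hab) * t₃ i a c hia (hab.trans hbc)} ∪
  {p | ∃ (i j a b c : Fin n) (hij : i < j) (hja : j < a) (hab : a < b) (hbc : b < c),
      p = t₂ j a hja * t₃ i b c (hij.trans (hja.trans hab)) hbc ∨
      p = t₂ j b (hja.trans hab) * t₃ i a c (hij.trans hja) (hab.trans hbc) ∨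
      p = t₂ j c (hja.trans (hab.trans hbc)) * t₃ i a b (hij.trans hja) hab ∨
      p = t₂ a b hab * t₃ i j c hij (hja.trans (hab.trans hbc)) ∨
      p = t₂ a c (hab.trans hbc) * t₃ i j b hij (hja.trans hab) ∨
      p = t₂ b c hbc * t₃ i j a hij hja}

/-- The set `S` of quadratic monomials in the `t'`. -/
def S (n : ℕ) : Set (Poly n) := S₁ n ∪ S₂ n

end Fricke

/-! ### Reduction of statements about `gr^k(J)` to ideals of `ℚ[t]` -/

namespace Fricke

open Matrix MvPolynomial

/-! Pulled back to `ℚ[t]`, the power `J^k` becomes `J₀^k + I_ℚ`, so everything is a question about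
polynomials modulo `J₀^(k+1) + I_ℚ`: an upper bound (spanning) and a lower bound (independence).

Spanning in degree 2 uses the geometry of the three-dimensional space of traceless matrices. Up to
terms that are easy to control, `t'_{ij}` is the trace form of the traceless parts of `ρ(x_i)` and
`ρ(x_j)` (the polynomial `U`), and `t'_{ijk}` is their determinant form (the polynomial `V`). A
product of two determinants is a Gram determinant, cubic in the `U`, so products `t'_{ijk} t'_{abc}`
reduce to lower types (`V_mul_V_mem`). Four vectors in a three-dimensional space are dependent,
which gives four-term relations between the products `t'_{pq} t'_{abc}`
(`q_mul_t₃_relation_mem_spanS`). Each product of this type outside `S` is removed by one such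
relation.

Independence is tested on a curve of representations through the trivial one, sending `x_i` to the
Cayley transform of `z Y_i` with `Y_i` traceless. There `t'_s` equals `4 z² quad + 8 z³ minor +
O(z⁴)` (`trace_cayleyRep`), and elements of `J₀^k + I_ℚ` are `O(z^(2k))`. A linear or quadratic
combination of the `t'` lying one filtration step too deep therefore has its two leading
coefficients equal to zero for all choices of the `Y_i` (`linear_expansion`, `quadratic_expansion`).
In degree 1 this kills all coefficients, which also yields `I_ℚ ⊆ J₀²`. In degree 2 the `z⁵`
coefficient, polarized, is a tensor with the symmetries treated in `eq_zero_of_excluded`; it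
vanishes at the positions missing from `S`, hence everywhere. What remains involves only `t'_i` and
`t'_{ij}`, and the `z⁴` coefficient disposes of it (`coeff_eq_zero`). -/

theorem T_eq_range (n : ℕ) : T n = Set.range (t' : Index n → Poly n) := by
  ext p
  constructor
  · rintro ((⟨i, rfl⟩ | ⟨i, j, h, rfl⟩) | ⟨i, j, k, h, h', rfl⟩)
    exacts [⟨_, rfl⟩, ⟨_, rfl⟩, ⟨_, rfl⟩]
  · rintro ⟨i | ⟨i, j, h⟩ | ⟨i, j, k, h, h'⟩, rfl⟩
    exacts [.inl (.inl ⟨_, rfl⟩), .inl (.inr ⟨_, _, _, rfl⟩), .inr ⟨_, _, _, _, _, rfl⟩]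

theorem J₀_eq_span (n : ℕ) : J₀ n = Ideal.span (Set.range t') := by
  rw [J₀, T_eq_range]

theorem t'_mem_J₀ {n : ℕ} (s : Index n) : t' s ∈ J₀ n := by
  rw [J₀_eq_span]
  exact Ideal.subset_span ⟨s, rfl⟩

/-- Every polynomial is a constant modulo `J₀`. -/
theorem exists_sub_C_mem_J₀ {n : ℕ} (p : Poly n) : ∃ a : ℚ, p - C a ∈ J₀ n := by
  induction p using MvPolynomial.induction_on with
  | C a => exact ⟨a, by simp⟩
  | add p q hp hq =>
    obtain ⟨a, ha⟩ := hp
    obtain ⟨b, hb⟩ := hq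
    refine ⟨a + b, ?_⟩
    have := add_mem ha hb
    rw [C_add]
    convert this using 1
    ring
  | mul_X p s hp =>
    obtain ⟨a, ha⟩ := hp
    -- Modulo `J₀` every indeterminate is the constant 2.
    refine ⟨a * 2, ?_⟩
    have h1 := (J₀ n).mul_mem_right (X s) ha
    have h2 := (J₀ n).mul_mem_left (C a) (t'_mem_J₀ s)
    have := add_mem h1 h2
    convert this using 1
    rw [t', C_mul]
    have : (C (2 : ℚ) : Poly n) = 2 := map_ofNat C 2
    rw [this]
    ring

/-- An ideal generated by `B` is spanned over `ℚ` by `B`, modulo its product with `J₀`. -/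
theorem span_le_span_rat_sup {n : ℕ} (B : Set (Poly n)) {p : Poly n} (hp : p ∈ Ideal.span B) :
    p ∈ Submodule.span ℚ B ⊔ (J₀ n * Ideal.span B).restrictScalars ℚ := by
  refine Submodule.span_induction ?_ ?_ ?_ ?_ hp
  · exact fun x hx => Submodule.mem_sup_left (Submodule.subset_span hx)
  · exact zero_mem _
  · exact fun x y _ _ hx hy => add_mem hx hy
  · intro r x hx hx'
    obtain ⟨a, ha⟩ := exists_sub_C_mem_J₀ r
    have : r • x = a • x + (r - C a) * x := by
      rw [MvPolynomial.smul_eq_C_mul, smul_eq_mul]; ring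
    rw [this]
    exact add_mem (Submodule.smul_mem _ _ hx')
      (Submodule.mem_sup_right (Ideal.mul_mem_mul ha hx))

theorem J_eq_map {n : ℕ} {G : Type*} [Group G] (x : Fin n → G) :
    J x = (J₀ n).map (Ideal.Quotient.mk (IQ x)) := by
  rw [J, J₀_eq_span, Ideal.map_span, ← Set.range_comp]
  rfl

theorem J_pow_eq_map {n : ℕ} {G : Type*} [Group G] (x : Fin n → G) (k : ℕ) :
    J x ^ k = (J₀ n ^ k).map (Ideal.Quotient.mk (IQ x)) := by
  rw [J_eq_map, Ideal.map_pow]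

theorem cls_mem_J_pow_iff {n : ℕ} {G : Type*} [Group G] (x : Fin n → G) (k : ℕ) (p : Poly n) :
    cls x p ∈ J x ^ k ↔ p ∈ J₀ n ^ k ⊔ IQ x := by
  rw [J_pow_eq_map, ← Ideal.mem_comap,
    Ideal.comap_map_of_surjective' _ Ideal.Quotient.mk_surjective, Ideal.mk_ker]

/-- The map `J₀ ^ k → gr^k(J)`. -/
noncomputable def toGr {n : ℕ} {G : Type*} [Group G] (x : Fin n → G) (k : ℕ) :
    (J₀ n ^ k).restrictScalars ℚ →ₗ[ℚ] Gr x k where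
  toFun p := grMk x k (cls x p.1) ((cls_mem_J_pow_iff x k _).2 (Ideal.mem_sup_left p.2))
  map_add' _ _ := rfl
  map_smul' _ _ := rfl

theorem toGr_eq_zero_iff {n : ℕ} {G : Type*} [Group G] (x : Fin n → G) (k : ℕ)
    (p : (J₀ n ^ k).restrictScalars ℚ) :
    toGr x k p = 0 ↔ (p : Poly n) ∈ J₀ n ^ (k + 1) ⊔ IQ x := by
  rw [← cls_mem_J_pow_iff]
  exact (Submodule.Quotient.mk_eq_zero _).trans Iff.rfl

theorem toGr_surjective {n : ℕ} {G : Type*} [Group G] (x : Fin n → G) (k : ℕ) :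
    Function.Surjective (toGr x k) := by
  intro y
  obtain ⟨⟨a, ha⟩, rfl⟩ := Submodule.Quotient.mk_surjective _ y
  have ha' := ha
  rw [J_pow_eq_map, Ideal.mem_map_iff_of_surjective _ Ideal.Quotient.mk_surjective] at ha'
  obtain ⟨p, hp, rfl⟩ := ha'
  exact ⟨⟨p, hp⟩, rfl⟩

/-- A criterion for a set of polynomials to induce a basis of `gr^k(J)`. -/
theorem isGrBasis_of {n : ℕ} {G : Type*} [Group G] (x : Fin n → G) (k : ℕ) (B : Set (Poly n))
    (hB : ∀ p ∈ B, p ∈ J₀ n ^ k)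
    (hspan : ∀ p ∈ J₀ n ^ k,
      p ∈ Submodule.span ℚ B ⊔ (J₀ n ^ (k + 1) ⊔ IQ x).restrictScalars ℚ)
    (hli : ∀ c : B →₀ ℚ, (c.sum fun p a => a • (p : Poly n)) ∈ J₀ n ^ (k + 1) ⊔ IQ x → c = 0) :
    IsGrBasis x k B := by
  let w : B → (J₀ n ^ k).restrictScalars ℚ := fun p => ⟨p, hB p p.2⟩
  have hw : ∀ c : B →₀ ℚ, ((Finsupp.linearCombination ℚ w c : _) : Poly n) =
      c.sum fun p a => a • (p : Poly n) := by
    intro c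
    rw [Finsupp.linearCombination_apply, Finsupp.sum, Finsupp.sum, AddSubmonoidClass.coe_finsetSum]
    rfl
  have h1 : LinearIndependent ℚ (fun p => toGr x k (w p)) := by
    rw [linearIndependent_iff]
    intro c hc
    apply hli
    rw [← hw, ← toGr_eq_zero_iff, Finsupp.apply_linearCombination]
    exact hc
  have h2 : ⊤ ≤ Submodule.span ℚ (Set.range fun p => toGr x k (w p)) := by
    rintro y -
    obtain ⟨⟨p, hp⟩, rfl⟩ := toGr_surjective x k y
    obtain ⟨q, hq, r, hr, rfl⟩ := Submodule.mem_sup.1 (hspan p hp)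
    have hq' : q ∈ J₀ n ^ k := by
      refine (Submodule.span_le (p := (J₀ n ^ k).restrictScalars ℚ)).2 ?_ hq
      exact hB
    have hr' : r ∈ J₀ n ^ k := by
      have := (J₀ n ^ k).sub_mem hp hq'
      simpa using this
    have e : toGr x k ⟨q + r, hp⟩ = toGr x k ⟨q, hq'⟩ := by
      have h0 : toGr x k ⟨r, hr'⟩ = 0 := (toGr_eq_zero_iff x k _).2 hr
      have : (⟨q + r, hp⟩ : (J₀ n ^ k).restrictScalars ℚ) = ⟨q, hq'⟩ + ⟨r, hr'⟩ := rfl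
      rw [this, map_add, h0, add_zero]
    rw [e]
    have hq2 := hq
    rw [← Subtype.range_coe (s := B), Finsupp.mem_span_range_iff_exists_finsupp] at hq2
    obtain ⟨c, hc⟩ := hq2
    have : (⟨q, hq'⟩ : (J₀ n ^ k).restrictScalars ℚ) = Finsupp.linearCombination ℚ w c :=
      Subtype.ext (hc.symm.trans (hw c).symm)
    rw [this, Finsupp.apply_linearCombination]
    exact Finsupp.mem_span_range_iff_exists_finsupp.2 ⟨c, rfl⟩
  refine ⟨Module.Basis.mk h1 h2, fun p => ?_⟩
  exact ⟨(cls_mem_J_pow_iff x k _).2 (Ideal.mem_sup_left (hB p p.2)), by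
    rw [Module.Basis.mk_apply]; rfl⟩

/-! ### Quadratic monomials in the `t'` determine their unordered pair of factors -/

theorem t'_ne_zero {n : ℕ} (s : Index n) : t' s ≠ 0 := by
  intro h
  have := congrArg (MvPolynomial.eval fun _ => (3 : ℚ)) h
  simp [t'] at this
  norm_num at this

/-- Evaluation at the point with coordinate 2 at `s` and 3 elsewhere sends `t' s` to 0 and every
other `t'` to 1. -/
theorem eq_or_eq_of_t'_mul_eq {n : ℕ} {s r u v : Index n} (h : t' s * t' r = t' u * t' v) :
    s = u ∨ s = v := by
  classical
  by_contra hc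
  push Not at hc
  have := congrArg (MvPolynomial.eval fun w => if w = s then (2 : ℚ) else 3) h
  simp only [t', map_mul, map_sub, eval_X, if_true, if_neg hc.1.symm, if_neg hc.2.symm,
    map_ofNat] at this
  norm_num at this

theorem t'_injective {n : ℕ} : Function.Injective (t' : Index n → Poly n) := by
  intro s r h
  rcases eq_or_eq_of_t'_mul_eq (congrArg₂ (· * ·) h h) with h | h <;> exact h

theorem t'_mul_eq_iff {n : ℕ} {s r u v : Index n} :
    t' s * t' r = t' u * t' v ↔ s = u ∧ r = v ∨ s = v ∧ r = u := by
  constructor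
  · intro h
    rcases eq_or_eq_of_t'_mul_eq h with rfl | rfl
    · exact .inl ⟨rfl, t'_injective (mul_left_cancel₀ (t'_ne_zero _) h)⟩
    · rw [mul_comm (t' u)] at h
      exact .inr ⟨rfl, t'_injective (mul_left_cancel₀ (t'_ne_zero _) h)⟩
  · rintro (⟨rfl, rfl⟩ | ⟨rfl, rfl⟩)
    exacts [rfl, mul_comm _ _]

/-- An injective code of the indices, witnessing that there are finitely many. -/
def Index.code {n : ℕ} : Index n → Fin n × Option (Fin n) × Option (Fin n)
  | .one i => (i, none, none)
  | .two i j _ => (i, some j, none)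
  | .three i j k _ _ => (i, some j, some k)

theorem Index.code_injective {n : ℕ} : Function.Injective (Index.code (n := n)) := by
  rintro (_ | _ | _) (_ | _ | _) h <;> simp_all [Index.code]

noncomputable instance {n : ℕ} : Fintype (Index n) := Fintype.ofInjective _ Index.code_injective

/-! ### Trace identities for traceless parts -/

/-- The bilinear form `tr (M₀ N₀)` of the traceless parts of two matrices. -/
noncomputable def dotTr (M N : Matrix (Fin 2) (Fin 2) ℂ) : ℂ :=
  (M 0 0 - M 1 1) * (N 0 0 - N 1 1) / 2 + M 0 1 * N 1 0 + M 1 0 * N 0 1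

/-- The trilinear form `tr (M₀ N₀ K₀)` of the traceless parts of three matrices. -/
noncomputable def tripleTr (M N K : Matrix (Fin 2) (Fin 2) ℂ) : ℂ :=
  ((M 0 0 - M 1 1) * (N 0 1 * K 1 0 - N 1 0 * K 0 1)
    - M 0 1 * ((N 0 0 - N 1 1) * K 1 0 - N 1 0 * (K 0 0 - K 1 1))
    + M 1 0 * ((N 0 0 - N 1 1) * K 0 1 - N 0 1 * (K 0 0 - K 1 1))) / 2

theorem dotTr_comm (M N : Matrix (Fin 2) (Fin 2) ℂ) : dotTr M N = dotTr N M := by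
  simp only [dotTr]; ring

theorem dotTr_eq (M N : Matrix (Fin 2) (Fin 2) ℂ) :
    dotTr M N = (M * N).trace - M.trace * N.trace / 2 := by
  simp only [dotTr, trace_fin_two, mul_apply, Fin.sum_univ_two]; ring

theorem tripleTr_eq (M N K : Matrix (Fin 2) (Fin 2) ℂ) :
    tripleTr M N K = (M * N * K).trace - (M.trace * (N * K).trace + N.trace * (M * K).trace
      + K.trace * (M * N).trace) / 2 + M.trace * N.trace * K.trace / 2 := by
  simp only [tripleTr, trace_fin_two, mul_apply, Fin.sum_univ_two]; ring

theorem dotTr_self (M : SpecialLinearGroup (Fin 2) ℂ) :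
    dotTr M M = (M : Matrix (Fin 2) (Fin 2) ℂ).trace ^ 2 / 2 - 2 := by
  have h := M.2
  rw [det_fin_two] at h
  simp only [dotTr, trace_fin_two]
  linear_combination (-2) * h

/-- `tripleTr` is a multiple of the determinant on the three-dimensional space of traceless
matrices, so the product of two values is a multiple of the Gram determinant of `dotTr`. -/
theorem tripleTr_mul_tripleTr (M N K M' N' K' : Matrix (Fin 2) (Fin 2) ℂ) :
    tripleTr M N K * tripleTr M' N' K' =
      -(dotTr M M' * (dotTr N N' * dotTr K K' - dotTr N K' * dotTr K N')
        - dotTr M N' * (dotTr N M' * dotTr K K' - dotTr N K' * dotTr K M')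
        + dotTr M K' * (dotTr N M' * dotTr K N' - dotTr N N' * dotTr K M')) / 2 := by
  simp only [tripleTr, dotTr]
  -- Diagonal entries enter only through their differences; naming these keeps the polynomial
  -- identity small.
  generalize M 0 0 - M 1 1 = a₁
  generalize N 0 0 - N 1 1 = a₂
  generalize K 0 0 - K 1 1 = a₃
  generalize M' 0 0 - M' 1 1 = a₄
  generalize N' 0 0 - N' 1 1 = a₅
  generalize K' 0 0 - K' 1 1 = a₆
  ring

/-- The four traceless parts of `M`, `N`, `K`, `P` lie in a three-dimensional space; this is their
Cramer dependence relation, paired with `L`. -/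
theorem dotTr_tripleTr_relation (L M N K P : Matrix (Fin 2) (Fin 2) ℂ) :
    dotTr L M * tripleTr N K P - dotTr L N * tripleTr M K P + dotTr L K * tripleTr M N P
      - dotTr L P * tripleTr M N K = 0 := by
  simp only [tripleTr, dotTr]
  ring

/-! ### Lifting the trace identities to `ℚ[t]` -/

section Polynomials

variable {n : ℕ}

/-- The symmetric family `t'_{ij}`, with the value `0` on the diagonal. -/
noncomputable def q (i j : Fin n) : Poly n :=
  if h : i < j then t₂ i j h else if h : j < i then t₂ j i h else 0

/-- A polynomial with value `tr (A₀ B₀)`, for `A₀` and `B₀` the traceless parts of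
`ρ(x_i)` and `ρ(x_j)`. -/
noncomputable def U (i j : Fin n) : Poly n :=
  if i = j then 2 * t₁ i + C (1 / 2) * t₁ i ^ 2
  else q i j - t₁ i - t₁ j - C (1 / 2) * (t₁ i * t₁ j)

/-- A polynomial with value `tr (A₀ B₀ C₀)`, for `A₀`, `B₀`, `C₀` the traceless parts of
`ρ(x_i)`, `ρ(x_j)`, `ρ(x_k)`. -/
noncomputable def V (i j k : Fin n) (hij : i < j) (hjk : j < k) : Poly n :=
  t₃ i j k hij hjk + 2
    - C (1 / 2) * ((t₁ i + 2) * (t₂ j k hjk + 2) + (t₁ j + 2) * (t₂ i k (hij.trans hjk) + 2)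
      + (t₁ k + 2) * (t₂ i j hij + 2))
    + C (1 / 2) * ((t₁ i + 2) * (t₁ j + 2) * (t₁ k + 2))

variable {G : Type*} [Group G] (x : Fin n → G) (ρ : Rep G)

theorem piQ_C_apply (a : ℚ) : piQ x (C a) ρ = a := by
  simp [piQ]

theorem piQ_two_apply : piQ x 2 ρ = 2 := by
  rw [map_ofNat]; rfl

theorem coe_rep_mul (a b : G) : (ρ (a * b) : Matrix (Fin 2) (Fin 2) ℂ) = ρ a * ρ b := by
  rw [map_mul]; rfl

theorem piQ_t'_apply (s : Index n) :
    piQ x (t' s) ρ = trace (ρ (s.word x) : Matrix (Fin 2) (Fin 2) ℂ) - 2 := by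
  rw [t', map_sub, Pi.sub_apply, piQ_two_apply]
  simp [piQ, tr]

theorem q_comm (i j : Fin n) : q i j = q j i := by
  rcases lt_trichotomy i j with h | rfl | h
  · simp [q, h, h.asymm]
  · rfl
  · simp [q, h, h.asymm]

theorem U_comm (i j : Fin n) : U i j = U j i := by
  by_cases h : i = j
  · rw [h]
  · rw [U, U, if_neg h, if_neg (Ne.symm h), q_comm]; ring

theorem q_of_lt {i j : Fin n} (h : i < j) : q i j = t₂ i j h := by
  rw [q, dif_pos h]

theorem q_of_gt {i j : Fin n} (h : j < i) : q i j = t₂ j i h := by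
  rw [q_comm, q_of_lt]

theorem q_self (i : Fin n) : q i i = 0 := by
  simp [q]

theorem piQ_U_apply (i j : Fin n) : piQ x (U i j) ρ = dotTr (ρ (x i)) (ρ (x j)) := by
  have key : ∀ i j : Fin n, i < j → piQ x (U i j) ρ = dotTr (ρ (x i)) (ρ (x j)) := by
    intro i j h
    rw [U, if_neg h.ne, q_of_lt h]
    simp only [map_sub, map_mul (piQ x), Pi.sub_apply, Pi.mul_apply, piQ_t'_apply, piQ_C_apply,
      dotTr_eq, Index.word, coe_rep_mul]
    push_cast
    ring
  rcases lt_trichotomy i j with h | rfl | h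
  · exact key i j h
  · rw [U, if_pos rfl, dotTr_self]
    simp only [map_add, map_mul, map_pow, Pi.add_apply, Pi.mul_apply, Pi.pow_apply, piQ_t'_apply,
      piQ_C_apply, piQ_two_apply, Index.word]
    push_cast
    ring
  · rw [U_comm, dotTr_comm, key j i h]

theorem piQ_V_apply (i j k : Fin n) (hij : i < j) (hjk : j < k) :
    piQ x (V i j k hij hjk) ρ = tripleTr (ρ (x i)) (ρ (x j)) (ρ (x k)) := by
  simp only [V, map_add, map_sub, map_mul (piQ x), Pi.add_apply, Pi.sub_apply, Pi.mul_apply,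
    piQ_t'_apply, piQ_C_apply, piQ_two_apply, tripleTr_eq, Index.word, coe_rep_mul]
  push_cast
  ring

theorem mem_IQ_iff (p : Poly n) : p ∈ IQ x ↔ ∀ ρ : Rep G, piQ x p ρ = 0 := by
  rw [IQ, RingHom.mem_ker]
  exact funext_iff

theorem U_mul_V_relation_mem (m i j k l : Fin n) (hij : i < j) (hjk : j < k) (hkl : k < l) :
    U m i * V j k l hjk hkl - U m j * V i k l (hij.trans hjk) hkl
      + U m k * V i j l hij (hjk.trans hkl) - U m l * V i j k hij hjk ∈ IQ x := by
  rw [mem_IQ_iff]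
  intro ρ
  simp only [map_add, map_sub, map_mul, Pi.add_apply, Pi.sub_apply, Pi.mul_apply, piQ_U_apply,
    piQ_V_apply]
  exact dotTr_tripleTr_relation _ _ _ _ _

theorem q_mem_J₀ (i j : Fin n) : q i j ∈ J₀ n := by
  unfold q
  split_ifs
  exacts [t'_mem_J₀ _, t'_mem_J₀ _, zero_mem _]

theorem U_mem_J₀ (i j : Fin n) : U i j ∈ J₀ n := by
  unfold U
  split_ifs
  · rw [pow_two, ← mul_assoc]
    exact add_mem (Ideal.mul_mem_left _ _ (t'_mem_J₀ _)) (Ideal.mul_mem_left _ _ (t'_mem_J₀ _))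
  · rw [← mul_assoc]
    exact sub_mem (sub_mem (sub_mem (q_mem_J₀ _ _) (t'_mem_J₀ _)) (t'_mem_J₀ _))
      (Ideal.mul_mem_left _ _ (t'_mem_J₀ _))

/-- This form shows that `V` has no constant term, and that apart from `t₃` and three `t₂` terms
every summand carries a factor `t₁`. -/
theorem V_eq (i j k : Fin n) (hij : i < j) (hjk : j < k) :
    V i j k hij hjk = t₃ i j k hij hjk - t₂ i j hij - t₂ i k (hij.trans hjk) - t₂ j k hjk
      + t₁ i * (1 - C (1 / 2) * t₂ j k hjk + t₁ j + C (1 / 2) * (t₁ j * t₁ k))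
      + t₁ j * (1 - C (1 / 2) * t₂ i k (hij.trans hjk) + t₁ k)
      + t₁ k * (1 - C (1 / 2) * t₂ i j hij + t₁ i) := by
  have h : (2 : Poly n) * C (1 / 2) = 1 := by
    rw [← map_ofNat C 2, ← C_mul]; norm_num
  rw [V]
  linear_combination (-t₂ i j hij - t₂ i k (hij.trans hjk) - t₂ j k hjk - 2 + t₁ i + t₁ j + t₁ k
    + t₁ i * t₁ j + t₁ i * t₁ k + t₁ j * t₁ k) * h

theorem V_mem_J₀ (i j k : Fin n) (hij : i < j) (hjk : j < k) : V i j k hij hjk ∈ J₀ n := by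
  rw [V_eq]
  refine add_mem (add_mem (add_mem (sub_mem (sub_mem (sub_mem ?_ ?_) ?_) ?_) ?_) ?_) ?_
  any_goals exact t'_mem_J₀ _
  all_goals exact Ideal.mul_mem_right _ _ (t'_mem_J₀ _)

/-- By the Gram identity the product is `-D/2` modulo `I_ℚ`, and `D` is cubic in elements of `J₀`.
-/
theorem V_mul_V_mem (a b c d e f : Fin n) (hab : a < b) (hbc : b < c) (hde : d < e) (hef : e < f) :
    V a b c hab hbc * V d e f hde hef ∈ J₀ n ^ 3 ⊔ IQ x := by
  set D := U a d * (U b e * U c f - U b f * U c e) - U a e * (U b d * U c f - U b f * U c d)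
    + U a f * (U b d * U c e - U b e * U c d) with hD
  have h1 : V a b c hab hbc * V d e f hde hef + C (1 / 2) * D ∈ IQ x := by
    rw [mem_IQ_iff]
    intro ρ
    simp only [hD, map_add, map_sub, map_mul, Pi.add_apply, Pi.sub_apply, Pi.mul_apply,
      piQ_U_apply, piQ_V_apply, piQ_C_apply, tripleTr_mul_tripleTr]
    push_cast
    ring
  have h2 : D ∈ J₀ n ^ 3 := by
    have h (i j k l r s : Fin n) : U i j * (U k l * U r s) ∈ J₀ n ^ 3 := by
      rw [pow_succ', pow_two]
      exact Ideal.mul_mem_mul (U_mem_J₀ _ _) (Ideal.mul_mem_mul (U_mem_J₀ _ _) (U_mem_J₀ _ _))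
    simp only [hD, mul_sub]
    exact add_mem (sub_mem (sub_mem (h _ _ _ _ _ _) (h _ _ _ _ _ _)) (sub_mem (h _ _ _ _ _ _) (h _ _ _ _ _ _)))
      (sub_mem (h _ _ _ _ _ _) (h _ _ _ _ _ _))
  have := sub_mem (Ideal.mem_sup_right (S := J₀ n ^ 3) h1)
    (Ideal.mem_sup_left (T := IQ x) (Ideal.mul_mem_left _ (C (1 / 2)) h2))
  simpa using this

/-- The polynomials that are `ℚ`-combinations of `S` modulo `J₀ ^ 3` and `I_ℚ`. -/
noncomputable def spanS : Submodule ℚ (Poly n) :=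
  Submodule.span ℚ (S n) ⊔ (J₀ n ^ 3 ⊔ IQ x).restrictScalars ℚ

theorem mem_spanS_of_mem {p : Poly n} (hp : p ∈ J₀ n ^ 3 ⊔ IQ x) : p ∈ spanS x :=
  Submodule.mem_sup_right hp

theorem mem_spanS_of_mem_S {p : Poly n} (hp : p ∈ S n) : p ∈ spanS x :=
  Submodule.mem_sup_left (Submodule.subset_span hp)

theorem t₁_mul_t'_mem (i : Fin n) (s : Index n) : t₁ i * t' s ∈ S n := by
  left
  rcases s with j | ⟨j, k, h⟩ | ⟨j, k, l, h, h'⟩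
  · refine .inl (.inl (.inl ?_))
    rcases le_total i j with h | h
    · exact ⟨i, j, h, rfl⟩
    · exact ⟨j, i, h, mul_comm _ _⟩
  · exact .inl (.inl (.inr ⟨i, j, k, h, rfl⟩))
  · exact .inl (.inr ⟨i, j, k, l, h, h', rfl⟩)

theorem t₂_mul_t₂_mem (i j a b : Fin n) (hij : i < j) (hab : a < b) :
    t₂ i j hij * t₂ a b hab ∈ S n := by
  refine .inl (.inr ?_)
  rcases le_total (toLex (i, j)) (toLex (a, b)) with h | h
  · exact ⟨i, j, a, b, hij, hab, h, rfl⟩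
  · exact ⟨a, b, i, j, hab, hij, h, mul_comm _ _⟩

/-- Since `S` contains `t₁` times every generator, multiples of `t₁` by elements of `J₀` can be
ignored from here on. -/
theorem t₁_mul_mem_spanS (i : Fin n) {v : Poly n} (hv : v ∈ J₀ n) : t₁ i * v ∈ spanS x := by
  have h := J₀_eq_span n ▸ span_le_span_rat_sup (Set.range t') (J₀_eq_span n ▸ hv)
  obtain ⟨y, hy, z, hz, rfl⟩ := Submodule.mem_sup.1 h
  rw [mul_add]
  refine add_mem ?_ (mem_spanS_of_mem x (Ideal.mem_sup_left ?_))
  · refine Submodule.span_induction ?_ ?_ ?_ ?_ hy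
    · rintro _ ⟨s, rfl⟩
      exact mem_spanS_of_mem_S x (t₁_mul_t'_mem i s)
    · rw [mul_zero]; exact zero_mem _
    · intro a b _ _ ha hb
      rw [mul_add]; exact add_mem ha hb
    · intro a b _ hb
      rw [mul_smul_comm]; exact Submodule.smul_mem _ _ hb
  · rw [pow_succ', pow_two]
    refine Ideal.mul_mem_mul (t'_mem_J₀ _) ?_
    rw [← J₀_eq_span] at hz
    exact hz

theorem q_mul_t₂_mem_spanS (i j a b : Fin n) (hab : a < b) : q i j * t₂ a b hab ∈ spanS x := by
  unfold q
  split_ifs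
  · exact mem_spanS_of_mem_S x (t₂_mul_t₂_mem ..)
  · exact mem_spanS_of_mem_S x (t₂_mul_t₂_mem ..)
  · rw [zero_mul]; exact zero_mem _

theorem q_mul_V_sub_mem_spanS (m r i j k : Fin n) (hij : i < j) (hjk : j < k) :
    q m r * (V i j k hij hjk - t₃ i j k hij hjk) ∈ spanS x := by
  have key (l : Fin n) (p : Poly n) : t₁ l * (p * q m r) ∈ spanS x :=
    t₁_mul_mem_spanS x l (Ideal.mul_mem_left _ _ (q_mem_J₀ _ _))
  have h := add_mem (add_mem (add_mem (neg_mem (add_mem (add_mem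
    (q_mul_t₂_mem_spanS x m r i j hij) (q_mul_t₂_mem_spanS x m r i k (hij.trans hjk)))
    (q_mul_t₂_mem_spanS x m r j k hjk)))
    (key i (1 - C (1 / 2) * t₂ j k hjk + t₁ j + C (1 / 2) * (t₁ j * t₁ k))))
    (key j (1 - C (1 / 2) * t₂ i k (hij.trans hjk) + t₁ k)))
    (key k (1 - C (1 / 2) * t₂ i j hij + t₁ i))
  convert h using 1
  rw [V_eq]
  ring

/-- Terms with a factor `t₁` and products `t₂ t₂` are harmless. On the diagonal `U` consists of `t₁`
terms only, which is why `q` is set to 0 there. -/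
theorem U_mul_V_sub_mem_spanS (m r i j k : Fin n) (hij : i < j) (hjk : j < k) :
    U m r * V i j k hij hjk - q m r * t₃ i j k hij hjk ∈ spanS x := by
  have key (l : Fin n) (p : Poly n) : t₁ l * (p * V i j k hij hjk) ∈ spanS x :=
    t₁_mul_mem_spanS x l (Ideal.mul_mem_left _ _ (V_mem_J₀ _ _ _ _ _))
  by_cases h : m = r
  · subst h
    convert key m (2 + C (1 / 2) * t₁ m) using 1
    rw [U, if_pos rfl, q_self]
    ring
  · convert add_mem (add_mem (key m (-1 - C (1 / 2) * t₁ r)) (key r (-1)))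
      (q_mul_V_sub_mem_spanS x m r i j k hij hjk) using 1
    rw [U, if_neg h]
    ring

theorem q_mul_t₃_relation_mem_spanS (m i j k l : Fin n) (hij : i < j) (hjk : j < k) (hkl : k < l) :
    q m i * t₃ j k l hjk hkl - q m j * t₃ i k l (hij.trans hjk) hkl
      + q m k * t₃ i j l hij (hjk.trans hkl) - q m l * t₃ i j k hij hjk ∈ spanS x := by
  have h0 := mem_spanS_of_mem x
    (Ideal.mem_sup_right (S := J₀ n ^ 3) (U_mul_V_relation_mem x m i j k l hij hjk hkl))
  have h1 := U_mul_V_sub_mem_spanS x m i j k l hjk hkl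
  have h2 := U_mul_V_sub_mem_spanS x m j i k l (hij.trans hjk) hkl
  have h3 := U_mul_V_sub_mem_spanS x m k i j l hij (hjk.trans hkl)
  have h4 := U_mul_V_sub_mem_spanS x m l i j k hij hjk
  convert sub_mem h0 (sub_mem (add_mem (sub_mem h1 h2) h3) h4) using 1
  ring

end Polynomials

open scoped Pointwise

/-! ### Quadratic monomials are spanned by `S` -/

section Spanning

variable {n : ℕ}

/-- The condition on `p < q` and `a < b < c` under which `t'_{pq} t'_{abc}` is not in `S`. -/
def Excluded (p q a b c : Fin n) : Prop :=
  (p < a ∧ q ≠ a ∧ q ≠ b ∧ q ≠ c) ∨ (p = a ∧ c < q) ∨ (p = b ∧ c < q) ∨ p = c ∨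
    (b < p ∧ p < c ∧ q = c)

theorem t₂_mul_t₃_mem_S {p q a b c : Fin n} (hpq : p < q) (hab : a < b) (hbc : b < c)
    (h : ¬ Excluded p q a b c) : t₂ p q hpq * t₃ a b c hab hbc ∈ S n := by
  simp only [Excluded, not_or, not_and] at h
  obtain ⟨h1, h2, h3, h4, h5⟩ := h
  right
  rcases lt_trichotomy p a with ha | rfl | ha
  · left; right
    by_cases e1 : q = a
    · subst e1
      exact ⟨p, q, b, c, ha, hab, hbc, .inl rfl⟩
    by_cases e2 : q = b
    · subst e2
      exact ⟨p, a, q, c, ha, hab, hbc, .inr (.inl rfl)⟩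
    by_cases e3 : q = c
    · subst e3
      exact ⟨p, a, b, q, ha, hab, hbc, .inr (.inr (.inl rfl))⟩
    exact absurd e3 (h1 ha e1 e2)
  · left
    rcases lt_trichotomy q b with hb | rfl | hb
    · exact .inr ⟨p, q, b, c, hpq, hb, hbc, .inr (.inr (.inr (.inl rfl)))⟩
    · exact .inl ⟨p, q, c, hab, hbc, .inl rfl⟩
    rcases lt_trichotomy q c with hc | rfl | hc
    · exact .inr ⟨p, b, q, c, hab, hb, hc, .inr (.inr (.inr (.inr (.inr (.inr (.inr rfl))))))⟩
    · exact .inl ⟨p, b, q, hab, hbc, .inr (.inl rfl)⟩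
    · exact absurd hc (h2 rfl)
  rcases lt_trichotomy p b with hb | rfl | hb
  · rcases lt_trichotomy q b with hb' | rfl | hb'
    · exact .inr ⟨a, p, q, b, c, ha, hpq, hb', hbc, .inl rfl⟩
    · exact .inl (.inr ⟨a, p, q, c, ha, hb, hbc, .inr (.inr (.inr (.inr (.inr (.inl rfl)))))⟩)
    rcases lt_trichotomy q c with hc' | rfl | hc'
    · exact .inr ⟨a, p, b, q, c, ha, hb, hb', hc', .inr (.inl rfl)⟩
    · exact .inl (.inr ⟨a, p, b, q, ha, hb, hbc,
        .inr (.inr (.inr (.inr (.inr (.inr (.inl rfl))))))⟩)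
    · exact .inr ⟨a, p, b, c, q, ha, hb, hbc, hc', .inr (.inr (.inl rfl))⟩
  · left
    rcases lt_trichotomy q c with hc' | rfl | hc'
    · exact .inr ⟨a, p, q, c, hab, hpq, hc', .inr (.inr (.inr (.inr (.inl rfl))))⟩
    · exact .inl ⟨a, p, q, hab, hbc, .inr (.inr rfl)⟩
    · exact absurd hc' (h3 rfl)
  rcases lt_trichotomy p c with hc | rfl | hc
  · rcases lt_trichotomy q c with hc' | rfl | hc'
    · exact .inr ⟨a, b, p, q, c, hab, hb, hpq, hc', .inr (.inr (.inr (.inl rfl)))⟩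
    · exact absurd rfl (h5 hb hc)
    · exact .inr ⟨a, b, p, c, q, hab, hb, hc, hc', .inr (.inr (.inr (.inr (.inl rfl))))⟩
  · exact absurd rfl h4
  · exact .inr ⟨a, b, c, p, q, hab, hbc, hc, hpq, .inr (.inr (.inr (.inr (.inr rfl))))⟩

theorem t₂_mul_t₃_not_mem_S {p q a b c : Fin n} (hpq : p < q) (hab : a < b) (hbc : b < c)
    (h : Excluded p q a b c) : t₂ p q hpq * t₃ a b c hab hbc ∉ S n := by
  intro hS
  unfold Excluded at h
  rcases hS with (((⟨i, j, _, e⟩ | ⟨i, j, k, _, e⟩) | ⟨i, j, k, l, _, _, e⟩) |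
    ⟨i, j, k, l, _, _, _, e⟩) | ((⟨i, j, k, _, _, e | e | e⟩ |
    ⟨i, j, k, l, _, _, _, e | e | e | e | e | e | e | e⟩) |
    ⟨i, j, k, l, m, _, _, _, _, e | e | e | e | e | e⟩)
  all_goals
    rw [t'_mul_eq_iff] at e
    simp only [Index.two.injEq, Index.three.injEq, reduceCtorEq, and_false, false_and, or_false,
      or_self] at e
  all_goals
    obtain ⟨⟨rfl, rfl⟩, rfl, rfl, rfl⟩ := e
    grind

theorem t₃_mul_t₃_not_mem_S {p q r a b c : Fin n} (hpq : p < q) (hqr : q < r) (hab : a < b)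
    (hbc : b < c) : t₃ p q r hpq hqr * t₃ a b c hab hbc ∉ S n := by
  intro hS
  rcases hS with (((⟨i, j, _, e⟩ | ⟨i, j, k, _, e⟩) | ⟨i, j, k, l, _, _, e⟩) |
    ⟨i, j, k, l, _, _, _, e⟩) | ((⟨i, j, k, _, _, e | e | e⟩ |
    ⟨i, j, k, l, _, _, _, e | e | e | e | e | e | e | e⟩) |
    ⟨i, j, k, l, m, _, _, _, _, e | e | e | e | e | e⟩)
  all_goals
    rw [t'_mul_eq_iff] at e
    simp only [reduceCtorEq, and_false, false_and, or_self] at e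

theorem S_subset {p : Poly n} (hp : p ∈ S n) : ∃ s r : Index n, p = t' s * t' r := by
  rcases hp with (((⟨i, j, _, e⟩ | ⟨i, j, k, _, e⟩) | ⟨i, j, k, l, _, _, e⟩) |
    ⟨i, j, k, l, _, _, _, e⟩) | ((⟨i, j, k, _, _, e | e | e⟩ |
    ⟨i, j, k, l, _, _, _, e | e | e | e | e | e | e | e⟩) |
    ⟨i, j, k, l, m, _, _, _, _, e | e | e | e | e | e⟩)
  all_goals exact ⟨_, _, e⟩

variable {G : Type*} [Group G] (x : Fin n → G)

theorem q_mul_t₃_mem_spanS_of_not_excluded {p q a b c : Fin n} (hpq : p ≠ q) (hab : a < b)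
    (hbc : b < c) (h : ¬ Excluded (min p q) (max p q) a b c) :
    Fricke.q p q * t₃ a b c hab hbc ∈ spanS x := by
  rcases lt_or_gt_of_ne hpq with h' | h'
  · rw [q_of_lt h']
    rw [min_eq_left h'.le, max_eq_right h'.le] at h
    exact mem_spanS_of_mem_S x (t₂_mul_t₃_mem_S h' hab hbc h)
  · rw [q_of_gt h']
    rw [min_eq_right h'.le, max_eq_left h'.le] at h
    exact mem_spanS_of_mem_S x (t₂_mul_t₃_mem_S h' hab hbc h)

/-- For each clause of `Excluded` there is one four-term relation in which every other product is
either non-excluded or contains some `q m m = 0`. -/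
theorem t₂_mul_t₃_mem_spanS {p q a b c : Fin n} (hpq : p < q) (hab : a < b) (hbc : b < c) :
    t₂ p q hpq * t₃ a b c hab hbc ∈ spanS x := by
  by_cases h : Excluded p q a b c
  swap
  · exact mem_spanS_of_mem_S x (t₂_mul_t₃_mem_S hpq hab hbc h)
  rcases h with ⟨h, h1, h2, h3⟩ | ⟨rfl, h⟩ | ⟨rfl, h⟩ | rfl | ⟨h, h', rfl⟩
  -- With `p` least and the five indices distinct, the other three terms have `p` in the triple.
  · have r := q_mul_t₃_relation_mem_spanS x q p a b c h hab hbc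
    have r1 := q_mul_t₃_mem_spanS_of_not_excluded x h1 (h.trans hab) hbc (by grind [Excluded])
    have r2 := q_mul_t₃_mem_spanS_of_not_excluded x h2 h (hab.trans hbc) (by grind [Excluded])
    have r3 := q_mul_t₃_mem_spanS_of_not_excluded x h3 h hab (by grind [Excluded])
    convert add_mem (sub_mem (add_mem r r1) r2) r3 using 1
    rw [q_of_gt hpq]
    ring
  -- In this and the remaining cases the index shared by the pair and the triple is taken as `m`, so
  -- its own term drops out.
  · have r := q_mul_t₃_relation_mem_spanS x p p b c q hab hbc h
    have r1 := q_mul_t₃_mem_spanS_of_not_excluded x hab.ne (hab.trans hbc) h (by grind [Excluded])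
    have r2 := q_mul_t₃_mem_spanS_of_not_excluded x (hab.trans hbc).ne hab (hbc.trans h)
      (by grind [Excluded])
    convert neg_mem (sub_mem (add_mem r r1) r2) using 1
    rw [q_of_lt hpq, q_self]
    ring
  · have r := q_mul_t₃_relation_mem_spanS x p a p c q hab hbc h
    have r1 := q_mul_t₃_mem_spanS_of_not_excluded x hab.ne' hbc h (by grind [Excluded])
    have r2 := q_mul_t₃_mem_spanS_of_not_excluded x hbc.ne hab (hbc.trans h) (by grind [Excluded])
    convert neg_mem (sub_mem (sub_mem r r1) r2) using 1
    rw [q_of_lt hpq, q_self]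
    ring
  · have r := q_mul_t₃_relation_mem_spanS x p a b p q hab hbc hpq
    have r1 := q_mul_t₃_mem_spanS_of_not_excluded x (hab.trans hbc).ne' hbc hpq
      (by grind [Excluded])
    have r2 := q_mul_t₃_mem_spanS_of_not_excluded x hbc.ne' (hab.trans hbc) hpq
      (by grind [Excluded])
    convert neg_mem (add_mem (sub_mem r r1) r2) using 1
    rw [q_of_lt hpq, q_self]
    ring
  · have r := q_mul_t₃_relation_mem_spanS x q a b p q hab h h'
    have r1 := q_mul_t₃_mem_spanS_of_not_excluded x (hab.trans hbc).ne' h h' (by grind [Excluded])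
    have r2 := q_mul_t₃_mem_spanS_of_not_excluded x hbc.ne' (hab.trans h) h' (by grind [Excluded])
    convert add_mem (sub_mem r r1) r2 using 1
    rw [q_of_gt hpq, q_self]
    ring

theorem t₂_mul_V_mem_spanS {p q a b c : Fin n} (hpq : p < q) (hab : a < b) (hbc : b < c) :
    t₂ p q hpq * V a b c hab hbc ∈ spanS x := by
  have h := q_mul_V_sub_mem_spanS x p q a b c hab hbc
  rw [q_of_lt hpq] at h
  convert add_mem h (t₂_mul_t₃_mem_spanS x hpq hab hbc) using 1
  ring

/-- This replaces `V` by `t₃` in one factor at a time; it is used with `v` first a `V` and then a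
`t₃`. -/
theorem V_sub_mul_mem_spanS {a b c : Fin n} (hab : a < b) (hbc : b < c) {v : Poly n}
    (hv : v ∈ J₀ n) (h : ∀ (p q : Fin n) (hpq : p < q), t₂ p q hpq * v ∈ spanS x) :
    (V a b c hab hbc - t₃ a b c hab hbc) * v ∈ spanS x := by
  have key (l : Fin n) (p : Poly n) : t₁ l * (p * v) ∈ spanS x :=
    t₁_mul_mem_spanS x l (Ideal.mul_mem_left _ _ hv)
  convert add_mem (add_mem (add_mem (neg_mem (add_mem (add_mem (h a b hab)
    (h a c (hab.trans hbc))) (h b c hbc)))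
    (key a (1 - C (1 / 2) * t₂ b c hbc + t₁ b + C (1 / 2) * (t₁ b * t₁ c))))
    (key b (1 - C (1 / 2) * t₂ a c (hab.trans hbc) + t₁ c)))
    (key c (1 - C (1 / 2) * t₂ a b hab + t₁ a)) using 1
  rw [V_eq]
  ring

theorem t₃_mul_t₃_mem_spanS {p q r a b c : Fin n} (hpq : p < q) (hqr : q < r) (hab : a < b)
    (hbc : b < c) : t₃ p q r hpq hqr * t₃ a b c hab hbc ∈ spanS x := by
  have h0 := mem_spanS_of_mem x (V_mul_V_mem x p q r a b c hpq hqr hab hbc)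
  have h1 := V_sub_mul_mem_spanS x hpq hqr (V_mem_J₀ a b c hab hbc)
    fun _ _ h => t₂_mul_V_mem_spanS x h hab hbc
  have h2 := V_sub_mul_mem_spanS x hab hbc (t'_mem_J₀ (.three p q r hpq hqr))
    fun _ _ h => t₂_mul_t₃_mem_spanS x h hpq hqr
  convert sub_mem (sub_mem h0 h1) h2 using 1
  ring

theorem t'_mul_t'_mem_spanS (s r : Index n) : t' s * t' r ∈ spanS x := by
  rcases s with i | ⟨i, j, h⟩ | ⟨i, j, k, h, h'⟩
  · exact mem_spanS_of_mem_S x (t₁_mul_t'_mem _ _)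
  · rcases r with a | ⟨a, b, e⟩ | ⟨a, b, c, e, e'⟩
    · rw [mul_comm]
      exact mem_spanS_of_mem_S x (t₁_mul_t'_mem _ _)
    · exact mem_spanS_of_mem_S x (t₂_mul_t₂_mem ..)
    · exact t₂_mul_t₃_mem_spanS x h e e'
  · rcases r with a | ⟨a, b, e⟩ | ⟨a, b, c, e, e'⟩
    · rw [mul_comm]
      exact mem_spanS_of_mem_S x (t₁_mul_t'_mem _ _)
    · rw [mul_comm]
      exact t₂_mul_t₃_mem_spanS x e h h'
    · exact t₃_mul_t₃_mem_spanS x h h' e e'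

theorem J₀_sq_le_spanS {p : Poly n} (hp : p ∈ J₀ n ^ 2) : p ∈ spanS x := by
  have e : J₀ n ^ 2 = Ideal.span (Set.range (t' : Index n → Poly n) * Set.range t') := by
    rw [pow_two, J₀_eq_span, Ideal.span_mul_span']
  have h := span_le_span_rat_sup _ (e ▸ hp)
  rw [← e, ← pow_succ'] at h
  obtain ⟨y, hy, z, hz, rfl⟩ := Submodule.mem_sup.1 h
  refine add_mem ?_ (mem_spanS_of_mem x (Ideal.mem_sup_left hz))
  refine (Submodule.span_le (p := spanS x)).2 ?_ hy
  rintro _ ⟨_, ⟨s, rfl⟩, _, ⟨r, rfl⟩, rfl⟩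
  exact t'_mul_t'_mem_spanS x s r

end Spanning

/-! ### A curve of representations and its trace expansion -/

open Filter Topology Asymptotics

/-- The sum of a function over the entries of an index. -/
def Index.sum {n : ℕ} (P : Fin n → ℂ) : Index n → ℂ
  | .one i => P i
  | .two i j _ => P i + P j
  | .three i j k _ _ => P i + P j + P k

/-- The determinant with rows `(P r, Q r, R r)`, for `r` running through `i`, `j`, `k`. -/
def det₃ {n : ℕ} (P Q R : Fin n → ℂ) (i j k : Fin n) : ℂ :=
  P i * (Q j * R k - R j * Q k) - Q i * (P j * R k - R j * P k) + R i * (P j * Q k - Q j * P k)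

/-- The minor of the matrix with columns `P`, `Q`, `R` on the rows given by an index of length
three, and `0` for the other indices. -/
def Index.minor {n : ℕ} (P Q R : Fin n → ℂ) : Index n → ℂ
  | .one _ => 0
  | .two _ _ _ => 0
  | .three i j k _ _ => det₃ P Q R i j k

/-- The quadratic form `-det` of the sum of the traceless matrices `!![P i, Q i; R i, -P i]` over
the entries `i` of an index. -/
def Index.quad {n : ℕ} (P Q R : Fin n → ℂ) (s : Index n) : ℂ :=
  s.sum P ^ 2 + s.sum Q * s.sum R

section Cayley

variable {n : ℕ} (P Q R : Fin n → ℂ) (z : ℂ)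

/-- The bilinear form of the traceless matrices with coordinates `(P, Q, R)`. -/
noncomputable def polar (i j : Fin n) : ℂ := P i * P j + (Q i * R j + R i * Q j) / 2

/-- The scalar `y / (1 - z² y)`, where `y = P² + Q R`. -/
noncomputable def cayleyScalar (i : Fin n) : ℂ :=
  (P i ^ 2 + Q i * R i) / (1 - z ^ 2 * (P i ^ 2 + Q i * R i))

/-- The Cayley transform `(1 + z Y) / (1 - z Y)` of `Y = !![P, Q; R, -P]`. -/
noncomputable def cayley (i : Fin n) : Matrix (Fin 2) (Fin 2) ℂ :=
  let h := cayleyScalar P Q R z i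
  !![1 + 2 * z ^ 2 * h + 2 * z * (1 + z ^ 2 * h) * P i, 2 * z * (1 + z ^ 2 * h) * Q i;
     2 * z * (1 + z ^ 2 * h) * R i, 1 + 2 * z ^ 2 * h - 2 * z * (1 + z ^ 2 * h) * P i]

variable {P Q R z}

theorem cayleyScalar_eq {i : Fin n} (hz : 1 - z ^ 2 * (P i ^ 2 + Q i * R i) ≠ 0) :
    cayleyScalar P Q R z i =
      (P i ^ 2 + Q i * R i) * (1 + z ^ 2 * cayleyScalar P Q R z i) := by
  have h : cayleyScalar P Q R z i * (1 - z ^ 2 * (P i ^ 2 + Q i * R i)) = P i ^ 2 + Q i * R i :=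
    div_mul_cancel₀ _ hz
  linear_combination h

theorem det_cayley {i : Fin n} (hz : 1 - z ^ 2 * (P i ^ 2 + Q i * R i) ≠ 0) :
    (cayley P Q R z i).det = 1 := by
  have h := cayleyScalar_eq hz
  rw [cayley, det_fin_two_of]
  linear_combination (4 * z ^ 2 * (1 + z ^ 2 * cayleyScalar P Q R z i)) * h

/-- The Cayley transform as an element of `SL(2, ℂ)`. -/
noncomputable def cayleySL {i : Fin n} (hz : 1 - z ^ 2 * (P i ^ 2 + Q i * R i) ≠ 0) :
    SpecialLinearGroup (Fin 2) ℂ :=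
  ⟨cayley P Q R z i, det_cayley hz⟩

/-- The representation of the free group given by the Cayley transforms. -/
noncomputable def cayleyRep (hz : ∀ i, 1 - z ^ 2 * (P i ^ 2 + Q i * R i) ≠ 0) :
    Rep (FreeGroup (Fin n)) :=
  FreeGroup.lift fun i => cayleySL (hz i)

variable (P Q R)

/-- The remainder of order four in the expansion of `t'` at the representation `cayleyRep`. -/
noncomputable def remainder (z : ℂ) : Index n → ℂ :=
  let h := cayleyScalar P Q R z
  let y := fun i => P i ^ 2 + Q i * R i
  let b := polar P Q R
  fun
  | .one i => 4 * (y i * h i)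
  | .two i j _ => 4 * (y i * h i + y j * h j) + 8 * (h i * h j)
      + 8 * (b i j * (h i + h j + z ^ 2 * (h i * h j)))
  | .three i j k _ _ => 4 * (y i * h i + y j * h j + y k * h k)
      + 8 * (h i * h j + h i * h k + h j * h k) + 16 * z ^ 2 * (h i * h j * h k)
      + 8 * (b i j * (h i + h j + z ^ 2 * (h i * h j)
        + 2 * h k * (1 + z ^ 2 * h i) * (1 + z ^ 2 * h j)))
      + 8 * (b i k * (h i + h k + z ^ 2 * (h i * h k)
        + 2 * h j * (1 + z ^ 2 * h i) * (1 + z ^ 2 * h k)))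
      + 8 * (b j k * (h j + h k + z ^ 2 * (h j * h k)
        + 2 * h i * (1 + z ^ 2 * h j) * (1 + z ^ 2 * h k)))
      + 8 * z * det₃ P Q R i j k * (h i + h j + h k + z ^ 2 * (h i * h j + h i * h k + h j * h k)
        + z ^ 4 * (h i * h j * h k))

/-- The value of `t'_s / z²` at the representation `cayleyRep`. -/
noncomputable def scaledValue (z : ℂ) (s : Index n) : ℂ :=
  4 * s.quad P Q R + 8 * z * s.minor P Q R + z ^ 2 * remainder P Q R z s

variable {P Q R}

/-- The traces are polynomial in `z`, the entries and the scalars `cayleyScalar`. The defining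
equation of these scalars is needed only to extract the leading part of the terms `4 z² h`. -/
theorem trace_cayleyRep (hz : ∀ i, 1 - z ^ 2 * (P i ^ 2 + Q i * R i) ≠ 0) (s : Index n) :
    trace (cayleyRep hz (s.word FreeGroup.of) : Matrix (Fin 2) (Fin 2) ℂ) =
      2 + z ^ 2 * scaledValue P Q R z s := by
  have hof (i : Fin n) : (cayleyRep hz (FreeGroup.of i) : Matrix (Fin 2) (Fin 2) ℂ) =
      cayley P Q R z i := by
    rw [cayleyRep, FreeGroup.lift_apply_of]
    rfl
  rcases s with i | ⟨i, j, hij⟩ | ⟨i, j, k, hij, hjk⟩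
  · have hi := cayleyScalar_eq (hz i)
    simp only [Index.word, hof, cayley, trace_fin_two_of, scaledValue, Index.quad, Index.sum,
      Index.minor, remainder]
    linear_combination (4 * z ^ 2) * hi
  · have hi := cayleyScalar_eq (hz i)
    have hj := cayleyScalar_eq (hz j)
    simp only [Index.word, coe_rep_mul, hof, cayley, mul_fin_two, trace_fin_two_of, scaledValue,
      Index.quad, Index.sum, Index.minor, remainder, polar]
    linear_combination (4 * z ^ 2) * (hi + hj)
  · have hi := cayleyScalar_eq (hz i)
    have hj := cayleyScalar_eq (hz j)
    have hk := cayleyScalar_eq (hz k)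
    simp only [Index.word, coe_rep_mul, hof, cayley, mul_fin_two, trace_fin_two_of, scaledValue,
      Index.quad, Index.sum, Index.minor, remainder, polar, det₃]
    linear_combination (4 * z ^ 2) * (hi + hj + hk)

variable (P Q R)

theorem continuousAt_cayleyScalar (i : Fin n) :
    ContinuousAt (fun z => cayleyScalar P Q R z i) 0 := by
  unfold cayleyScalar
  refine ContinuousAt.div (by fun_prop) (by fun_prop) (by simp)

theorem continuousAt_remainder (s : Index n) : ContinuousAt (fun z => remainder P Q R z s) 0 := by
  have h := continuousAt_cayleyScalar P Q R
  rcases s with i | ⟨i, j, hij⟩ | ⟨i, j, k, hij, hjk⟩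
  · have hi := h i
    simp only [remainder]
    fun_prop
  · have hi := h i
    have hj := h j
    simp only [remainder]
    fun_prop
  · have hi := h i
    have hj := h j
    have hk := h k
    simp only [remainder]
    fun_prop

theorem continuousAt_scaledValue (s : Index n) :
    ContinuousAt (fun z => scaledValue P Q R z s) 0 := by
  have := continuousAt_remainder P Q R s
  unfold scaledValue
  fun_prop

/-- Evaluation of polynomials at the representation `cayleyRep`. -/
noncomputable def evalCayley (z : ℂ) : Poly n →ₐ[ℚ] ℂ :=
  aeval fun s => 2 + z ^ 2 * scaledValue P Q R z s

theorem evalCayley_t' (z : ℂ) (s : Index n) :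
    evalCayley P Q R z (t' s) = z ^ 2 * scaledValue P Q R z s := by
  rw [t', map_sub, map_ofNat, evalCayley, aeval_X]
  ring

theorem evalCayley_C (z : ℂ) (a : ℚ) : evalCayley P Q R z (C a) = a := by
  simp [evalCayley]

theorem continuousAt_evalCayley (p : Poly n) :
    ContinuousAt (fun z => evalCayley P Q R z p) 0 := by
  induction p using MvPolynomial.induction_on with
  | C a => simpa only [evalCayley_C] using continuousAt_const
  | add p q hp hq =>
    simp only [map_add]
    exact hp.add hq
  | mul_X p s hp =>
    have := continuousAt_scaledValue P Q R s
    simp only [map_mul]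
    refine hp.mul ?_
    simp only [evalCayley, aeval_X]
    fun_prop

/-- Near `z = 0` no denominator vanishes, so `evalCayley` is evaluation at a genuine representation
and factors through `piQ`. -/
theorem evalCayley_eventually_eq_zero {p : Poly n}
    (hp : p ∈ IQ (FreeGroup.of : Fin n → FreeGroup (Fin n))) :
    ∀ᶠ z in 𝓝 0, evalCayley P Q R z p = 0 := by
  have hz : ∀ᶠ z : ℂ in 𝓝 0, ∀ i, 1 - z ^ 2 * (P i ^ 2 + Q i * R i) ≠ 0 := by
    rw [eventually_all]
    intro i
    have : ContinuousAt (fun z : ℂ => 1 - z ^ 2 * (P i ^ 2 + Q i * R i)) 0 := by fun_prop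
    exact this.eventually_ne (by simp)
  filter_upwards [hz] with z hz
  have h : evalCayley P Q R z =
      (Pi.evalAlgHom ℚ (fun _ : Rep (FreeGroup (Fin n)) => ℂ) (cayleyRep hz)).comp
        (piQ FreeGroup.of) := by
    refine MvPolynomial.algHom_ext fun s => ?_
    rw [evalCayley, aeval_X, ← trace_cayleyRep hz]
    simp [piQ, tr]
  rw [h]
  exact (mem_IQ_iff _ p).1 hp (cayleyRep hz)

/-- Each generator of `J₀` is `O(z²)` along the curve, and all evaluations stay bounded. -/
theorem evalCayley_isBigO {p : Poly n} {k : ℕ} (hp : p ∈ J₀ n ^ k) :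
    (fun z => evalCayley P Q R z p) =O[𝓝 0] fun z => z ^ (2 * k) := by
  have hone (p : Poly n) : (fun z => evalCayley P Q R z p) =O[𝓝 0] fun _ => (1 : ℂ) :=
    (continuousAt_evalCayley P Q R p).tendsto.isBigO_one ℂ
  induction k generalizing p with
  | zero => simpa using hone p
  | succ k ih =>
    rw [pow_succ'] at hp
    refine Submodule.mul_induction_on hp ?_ ?_
    · intro a ha b hb
      have h1 : (fun z => evalCayley P Q R z a) =O[𝓝 0] fun z => z ^ 2 := by
        rw [J₀_eq_span] at ha
        refine Submodule.span_induction ?_ ?_ ?_ ?_ ha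
        · rintro _ ⟨s, rfl⟩
          simp only [evalCayley_t']
          simpa using (isBigO_refl (fun z : ℂ => z ^ 2) (𝓝 0)).mul
            ((continuousAt_scaledValue P Q R s).tendsto.isBigO_one ℂ)
        · simpa using isBigO_zero _ _
        · intro a b _ _ ha hb
          simpa only [map_add] using ha.add hb
        · intro a b _ hb
          simpa only [smul_eq_mul, map_mul, one_mul] using (hone a).mul hb
      have e : (fun z : ℂ => z ^ (2 * (k + 1))) = fun z => z ^ 2 * z ^ (2 * k) := by
        funext z; ring
      rw [e]
      simpa only [map_mul] using h1.mul (ih hb)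
    · intro a b ha hb
      simpa only [map_add] using ha.add hb

theorem evalCayley_isBigO_of_mem_sup {p : Poly n} {k : ℕ}
    (hp : p ∈ J₀ n ^ k ⊔ IQ (FreeGroup.of : Fin n → FreeGroup (Fin n))) :
    (fun z => evalCayley P Q R z p) =O[𝓝 0] fun z => z ^ (2 * k) := by
  obtain ⟨a, ha, b, hb, rfl⟩ := Submodule.mem_sup.1 hp
  refine (evalCayley_isBigO P Q R ha).congr' ?_ EventuallyEq.rfl
  filter_upwards [evalCayley_eventually_eq_zero P Q R hb] with z hz
  rw [map_add, hz, add_zero]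

end Cayley

/-- After division by `z ^ k` away from 0, `a + b z = O(z²)`; the limit gives `a`, and a further
division by `z` gives `b`. -/
theorem eq_zero_of_isBigO {k : ℕ} {a b : ℂ} {r : ℂ → ℂ} (hr : ContinuousAt r 0)
    (h : (fun z : ℂ => z ^ k * (a + b * z + z ^ 2 * r z)) =O[𝓝 0] fun z => z ^ (k + 2)) :
    a = 0 ∧ b = 0 := by
  have hne : ∀ᶠ z : ℂ in 𝓝[≠] 0, z ≠ 0 := eventually_mem_nhdsWithin
  have h1 : (fun z : ℂ => a + b * z + z ^ 2 * r z) =O[𝓝[≠] 0] fun z => z ^ 2 := by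
    refine ((isBigO_refl (fun z : ℂ => (z ^ k)⁻¹) (𝓝[≠] 0)).mul (h.mono nhdsWithin_le_nhds)).congr'
      ?_ ?_
    · filter_upwards [hne] with z hz
      field_simp
    · filter_upwards [hne] with z hz
      field_simp
      ring
  have h2 : (fun z : ℂ => z ^ 2 * r z) =O[𝓝[≠] 0] fun z => z ^ 2 := by
    simpa using (isBigO_refl (fun z : ℂ => z ^ 2) (𝓝[≠] 0)).mul
      ((hr.tendsto.isBigO_one ℂ).mono nhdsWithin_le_nhds)
  have h3 : (fun z : ℂ => a + b * z) =O[𝓝[≠] 0] fun z => z ^ 2 := by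
    simpa using h1.sub h2
  have lim (m : ℕ) (hm : m ≠ 0) : Tendsto (fun z : ℂ => z ^ m) (𝓝[≠] 0) (𝓝 0) := by
    have : Tendsto (fun z : ℂ => z ^ m) (𝓝 0) (𝓝 (0 ^ m)) := (continuous_pow m).tendsto 0
    rw [zero_pow hm] at this
    exact this.mono_left nhdsWithin_le_nhds
  have ha : a = 0 := by
    have e1 := h3.trans_tendsto (lim 2 two_ne_zero)
    have e2 : Tendsto (fun z : ℂ => a + b * z) (𝓝[≠] 0) (𝓝 (a + b * 0)) :=
      (Continuous.tendsto (by fun_prop) 0).mono_left nhdsWithin_le_nhds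
    simpa using tendsto_nhds_unique e2 e1
  refine ⟨ha, ?_⟩
  subst ha
  have h4 : (fun _ : ℂ => b) =O[𝓝[≠] 0] fun z : ℂ => z ^ 1 := by
    refine ((isBigO_refl (fun z : ℂ => z⁻¹) (𝓝[≠] 0)).mul h3).congr' ?_ ?_
    · filter_upwards [hne] with z hz
      field_simp
      ring
    · filter_upwards [hne] with z hz
      field_simp
  exact tendsto_nhds_unique tendsto_const_nhds (h4.trans_tendsto (lim 1 one_ne_zero))

/-! ### Vanishing of the two leading coefficients -/

section Expansion

variable {n : ℕ}

theorem linear_expansion {a : ℚ} {c : Index n → ℚ}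
    (h : C a + ∑ s, C (c s) * t' s ∈
      J₀ n ^ 2 ⊔ IQ (FreeGroup.of : Fin n → FreeGroup (Fin n))) (P Q R : Fin n → ℂ) :
    a = 0 ∧ ∑ s, (c s : ℂ) * s.quad P Q R = 0 ∧ ∑ s, (c s : ℂ) * s.minor P Q R = 0 := by
  have h1 := evalCayley_isBigO_of_mem_sup P Q R h
  have e (z : ℂ) : evalCayley P Q R z (C a + ∑ s, C (c s) * t' s) =
      a + z ^ 2 * (4 * ∑ s, (c s : ℂ) * s.quad P Q R + 8 * (∑ s, (c s : ℂ) * s.minor P Q R) * z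
        + z ^ 2 * ∑ s, (c s : ℂ) * remainder P Q R z s) := by
    simp only [map_add, map_sum, map_mul, evalCayley_C, evalCayley_t', scaledValue, Finset.mul_sum,
      Finset.sum_mul, ← Finset.sum_add_distrib]
    congr 1
    exact Finset.sum_congr rfl fun s _ => by ring
  simp only [e] at h1
  have ha : (a : ℂ) = 0 := by
    -- The bound also holds at `z = 0` itself, where the right-hand side is 0.
    obtain ⟨B, hB⟩ := h1.bound
    simpa using hB.self_of_nhds
  rw [ha] at h1
  simp only [zero_add] at h1
  have hr : ContinuousAt (fun z => ∑ s, (c s : ℂ) * remainder P Q R z s) 0 :=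
    tendsto_finsetSum _ fun s _ => (continuousAt_remainder P Q R s).const_mul _
  obtain ⟨h2, h3⟩ := eq_zero_of_isBigO hr h1
  exact ⟨by exact_mod_cast ha, by simpa using h2, by simpa using h3⟩

theorem quadratic_expansion {c : Index n → Index n → ℚ}
    (h : ∑ s, ∑ r, C (c s r) * (t' s * t' r) ∈
      J₀ n ^ 3 ⊔ IQ (FreeGroup.of : Fin n → FreeGroup (Fin n))) (P Q R : Fin n → ℂ) :
    ∑ s, ∑ r, (c s r : ℂ) * (s.quad P Q R * r.quad P Q R) = 0 ∧
      ∑ s, ∑ r, (c s r : ℂ) * (s.quad P Q R * r.minor P Q R + s.minor P Q R * r.quad P Q R)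
        = 0 := by
  have h1 := evalCayley_isBigO_of_mem_sup P Q R h
  let E (z : ℂ) (s r : Index n) : ℂ :=
    4 * s.quad P Q R * remainder P Q R z r + 4 * remainder P Q R z s * r.quad P Q R
      + 64 * s.minor P Q R * r.minor P Q R
      + 8 * z * (s.minor P Q R * remainder P Q R z r + remainder P Q R z s * r.minor P Q R)
      + z ^ 2 * (remainder P Q R z s * remainder P Q R z r)
  have e (z : ℂ) : evalCayley P Q R z (∑ s, ∑ r, C (c s r) * (t' s * t' r)) =
      z ^ 4 * (16 * (∑ s, ∑ r, (c s r : ℂ) * (s.quad P Q R * r.quad P Q R))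
        + 32 * (∑ s, ∑ r, (c s r : ℂ) *
          (s.quad P Q R * r.minor P Q R + s.minor P Q R * r.quad P Q R)) * z
        + z ^ 2 * ∑ s, ∑ r, (c s r : ℂ) * E z s r) := by
    simp only [map_sum, map_mul, evalCayley_C, evalCayley_t', scaledValue, Finset.mul_sum,
      Finset.sum_mul, ← Finset.sum_add_distrib]
    exact Finset.sum_congr rfl fun s _ => Finset.sum_congr rfl fun r _ => by
      simp only [E]; ring
  simp only [e] at h1
  have hr : ContinuousAt (fun z => ∑ s, ∑ r, (c s r : ℂ) * E z s r) 0 := by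
    refine tendsto_finsetSum _ fun s _ => tendsto_finsetSum _ fun r _ => ?_
    have hs := continuousAt_remainder P Q R s
    have hr := continuousAt_remainder P Q R r
    have : ContinuousAt (fun z => (c s r : ℂ) * E z s r) 0 := by
      simp only [E]; fun_prop
    exact this
  obtain ⟨h2, h3⟩ := eq_zero_of_isBigO hr h1
  exact ⟨by simpa using h2, by simpa using h3⟩

end Expansion

/-! ### Tensors vanishing at the excluded positions -/

section Combinatorics

theorem eq_zero_of_alternating {n : ℕ} {f : Fin n → Fin n → Fin n → ℂ}
    (h12 : ∀ a b c, f a b c = -f b a c) (h23 : ∀ a b c, f a b c = -f a c b) (A : Fin n → Prop)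
    (h : ∀ a b c, a < b → b < c → A a → A b → A c → f a b c = 0) (a b c : Fin n)
    (ha : A a) (hb : A b) (hc : A c) : f a b c = 0 := by
  have e12 (a c) : f a a c = 0 := by linear_combination (1 / 2) * h12 a a c
  have e23 (a c) : f a c c = 0 := by linear_combination (1 / 2) * h23 a c c
  have e13 (a c) : f a c a = 0 := by rw [h12, e23, neg_zero]
  rcases lt_trichotomy a b with hab | rfl | hab
  · rcases lt_trichotomy b c with hbc | rfl | hbc
    · exact h a b c hab hbc ha hb hc
    · exact e23 _ _
    · rcases lt_trichotomy a c with hac | rfl | hac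
      · rw [h23, h a c b hac hbc ha hc hb, neg_zero]
      · exact e13 _ _
      · rw [h23, h12, h c a b hac hab hc ha hb, neg_zero, neg_zero]
  · exact e12 _ _
  · rcases lt_trichotomy a c with hac | rfl | hac
    · rw [h12, h b a c hab hac hb ha hc, neg_zero]
    · exact e13 _ _
    · rcases lt_trichotomy b c with hbc | rfl | hbc
      · rw [h12, h23, h b c a hbc hac hb hc ha, neg_zero, neg_zero]
      · exact e23 _ _
      · rw [h12, h23, h12, h c b a hbc hab hc hb ha, neg_zero, neg_zero, neg_zero]

/-- A tensor that is symmetric in two indices, alternating in the other three, satisfies a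
three-term relation, and vanishes at the excluded positions is zero. -/
theorem eq_zero_of_excluded {n : ℕ} {D : Fin n → Fin n → Fin n → Fin n → Fin n → ℂ}
    (hsymm : ∀ r s a b c, D r s a b c = D s r a b c)
    (h12 : ∀ r s a b c, D r s a b c = -D r s b a c)
    (h23 : ∀ r s a b c, D r s a b c = -D r s a c b)
    (hrel : ∀ i j k b c, D i j k b c + D i k j b c + D j k i b c = 0)
    (hexcl : ∀ p q a b c, p < q → a < b → b < c → Excluded p q a b c → D p q a b c = 0)
    (r s a b c : Fin n) : D r s a b c = 0 := by
  have hpp (p a b c) : D p p a b c = 0 := by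
    refine eq_zero_of_alternating (h12 p p) (h23 p p) (fun _ => True) ?_ a b c trivial trivial
      trivial
    intro a b c hab hbc _ _ _
    have e : D p p a b c = -2 * D p c p a b := by
      linear_combination hrel p p c a b + h23 p p a b c - h12 p p a c b
    suffices D p c p a b = 0 by rw [e, this, mul_zero]
    -- Each strict position of `p` relative to `a < b < c` meets one of the last four clauses of
    -- `Excluded`; in the cases of equality an index repeats, or `hrel` has three equal terms.
    rcases lt_trichotomy p a with h | rfl | h
    · exact hexcl _ _ _ _ _ (h.trans (hab.trans hbc)) h hab (by grind [Excluded])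
    · linear_combination (1 / 2) * h12 p c p p b
    rcases lt_trichotomy p b with h' | rfl | h'
    · rw [h12, hexcl p c a p b (h'.trans hbc) h h' (by grind [Excluded]), neg_zero]
    · have := h12 p c a p p
      linear_combination this - (1 / 2) * h23 p c a p p
    rcases lt_trichotomy p c with h'' | rfl | h''
    · rw [h12, h23, hexcl p c a b p h'' hab h' (by grind [Excluded]), neg_zero, neg_zero]
    · linear_combination (1 / 3) * hrel p p p a b
    · rw [hsymm, h12, h23, hexcl c p a b p h'' hab h' (by grind [Excluded]), neg_zero, neg_zero]
  have hpq (p q r s) : D p q p r s = 0 := by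
    linear_combination (1 / 2) * hrel p p q r s - (1 / 2) * hpp p q r s
  have hmin (p q x y z) (hpq' : p < q) (hx : p < x ∧ q ≠ x) (hy : p < y ∧ q ≠ y)
      (hz : p < z ∧ q ≠ z) : D p q x y z = 0 := by
    refine eq_zero_of_alternating (h12 p q) (h23 p q) (fun x => p < x ∧ q ≠ x) ?_ x y z hx hy hz
    intro a b c hab hbc ha hb hc
    exact hexcl p q a b c hpq' hab hbc (.inl ⟨ha.1, ha.2, hb.2, hc.2⟩)
  have key (r s a b c) (hrs : r < s) (hab : a < b) (hbc : b < c) : D r s a b c = 0 := by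
    by_cases e1 : r = a
    · rw [e1, hpq]
    by_cases e2 : r = b
    · rw [e2, h12, hpq, neg_zero]
    by_cases e3 : r = c
    · rw [e3, h23, h12, hpq, neg_zero, neg_zero]
    by_cases e4 : s = a
    · rw [e4, hsymm, hpq]
    by_cases e5 : s = b
    · rw [e5, hsymm, h12, hpq, neg_zero]
    by_cases e6 : s = c
    · rw [e6, hsymm, h23, h12, hpq, neg_zero, neg_zero]
    rcases lt_or_gt_of_ne e1 with h | h
    · exact hexcl r s a b c hrs hab hbc (.inl ⟨h, e4, e5, e6⟩)
    -- Here `a` is the least of five distinct indices; the relation moves it into the symmetric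
    -- pair, where `hmin` applies.
    · have := hrel a r s b c
      rw [hmin a r s b c h ⟨h.trans hrs, hrs.ne⟩ ⟨hab, e2⟩ ⟨hab.trans hbc, e3⟩,
        hmin a s r b c (h.trans hrs) ⟨h, hrs.ne'⟩ ⟨hab, e5⟩ ⟨hab.trans hbc, e6⟩] at this
      simpa using this
  refine eq_zero_of_alternating (h12 r s) (h23 r s) (fun _ => True) ?_ a b c trivial trivial
    trivial
  intro a b c hab hbc _ _ _
  rcases lt_trichotomy r s with h | rfl | h
  · exact key r s a b c h hab hbc
  · exact hpp _ _ _ _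
  · rw [hsymm]
    exact key s r a b c h hab hbc

end Combinatorics

/-! ### Recovering coefficients from the leading forms -/

section Forms

variable {n : ℕ}

theorem Index.sum_add (P P' : Fin n → ℂ) (s : Index n) : s.sum (P + P') = s.sum P + s.sum P' := by
  rcases s with i | ⟨i, j, h⟩ | ⟨i, j, k, h, h'⟩ <;> simp only [Index.sum, Pi.add_apply] <;> ring

theorem Index.sum_smul (a : ℂ) (P : Fin n → ℂ) (s : Index n) : s.sum (a • P) = a * s.sum P := by
  rcases s with i | ⟨i, j, h⟩ | ⟨i, j, k, h, h'⟩ <;>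
    simp only [Index.sum, Pi.smul_apply, smul_eq_mul] <;> ring

theorem Index.sum_zero (s : Index n) : s.sum (0 : Fin n → ℂ) = 0 := by
  rcases s with i | ⟨i, j, h⟩ | ⟨i, j, k, h, h'⟩ <;> simp [Index.sum]

theorem Index.minor_add (P P' Q R : Fin n → ℂ) (s : Index n) :
    s.minor (P + P') Q R = s.minor P Q R + s.minor P' Q R := by
  rcases s with i | ⟨i, j, h⟩ | ⟨i, j, k, h, h'⟩ <;>
    simp only [Index.minor, det₃, Pi.add_apply] <;> ring

theorem Index.minor_smul (a : ℂ) (P Q R : Fin n → ℂ) (s : Index n) :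
    s.minor (a • P) Q R = a * s.minor P Q R := by
  rcases s with i | ⟨i, j, h⟩ | ⟨i, j, k, h, h'⟩ <;>
    simp only [Index.minor, det₃, Pi.smul_apply, smul_eq_mul] <;> ring

theorem Index.minor_swap₁₂ (P Q R : Fin n → ℂ) (s : Index n) :
    s.minor P Q R = -s.minor Q P R := by
  rcases s with i | ⟨i, j, h⟩ | ⟨i, j, k, h, h'⟩ <;>
    simp only [Index.minor, det₃] <;> ring

theorem Index.minor_swap₂₃ (P Q R : Fin n → ℂ) (s : Index n) :
    s.minor P Q R = -s.minor P R Q := by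
  rcases s with i | ⟨i, j, h⟩ | ⟨i, j, k, h, h'⟩ <;>
    simp only [Index.minor, det₃] <;> ring

/-- The standard basis vectors. -/
noncomputable def e (i : Fin n) : Fin n → ℂ := Pi.single i 1

theorem e_apply (i j : Fin n) : e i j = if j = i then 1 else 0 := by
  rw [e, Pi.single_apply]

theorem Index.minor_e_self {a b c : Fin n} (hab : a < b) (hbc : b < c) :
    (Index.three a b c hab hbc).minor (e a) (e b) (e c) = 1 := by
  simp [Index.minor, det₃, e_apply, hab.ne, hab.ne', hbc.ne, hbc.ne', (hab.trans hbc).ne,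
    (hab.trans hbc).ne']

theorem Index.minor_e_of_ne {a b c : Fin n} (hab : a < b) (hbc : b < c) {s : Index n}
    (hs : s ≠ .three a b c hab hbc) : s.minor (e a) (e b) (e c) = 0 := by
  rcases s with i | ⟨i, j, h⟩ | ⟨i, j, k, h, h'⟩
  · rfl
  · rfl
  · simp only [ne_eq, Index.three.injEq] at hs
    simp only [Index.minor, det₃, e_apply]
    grind

theorem sum_mul_sum_e_of_lt {c : Index n → ℂ} (hc : ∀ i j k hij hjk, c (.three i j k hij hjk) = 0)
    {r s : Fin n} (hrs : r < s) :
    ∑ t, c t * (t.sum (e r) * t.sum (e s)) = c (.two r s hrs) := by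
  rw [Finset.sum_eq_single (.two r s hrs)]
  · simp [Index.sum, e_apply, hrs.ne, hrs.ne']
  · rintro (i | ⟨i, j, h⟩ | ⟨i, j, k, h, h'⟩) - ht
    · simp only [Index.sum, e_apply]
      grind
    · simp only [ne_eq, Index.two.injEq] at ht
      simp only [Index.sum, e_apply]
      grind
    · rw [hc, zero_mul]
  · simp

theorem sum_mul_sum_e_self {c : Index n → ℂ} (hc : ∀ i j k hij hjk, c (.three i j k hij hjk) = 0)
    (hc' : ∀ i j hij, c (.two i j hij) = 0) (r : Fin n) :
    ∑ t, c t * (t.sum (e r) * t.sum (e r)) = c (.one r) := by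
  rw [Finset.sum_eq_single (.one r)]
  · simp [Index.sum, e_apply]
  · rintro (i | ⟨i, j, h⟩ | ⟨i, j, k, h, h'⟩) - ht
    · simp only [ne_eq, Index.one.injEq] at ht
      simp [Index.sum, e_apply, ht]
    · rw [hc', zero_mul]
    · rw [hc, zero_mul]
  · simp

/-- Without triples, the mixed value at `e r`, `e s` sees only the index `{r, s}`; once those
coefficients vanish, the diagonal values give the rest. -/
theorem eq_zero_of_bilinear {c : Index n → ℂ}
    (hc : ∀ i j k hij hjk, c (.three i j k hij hjk) = 0)
    (h : ∀ r s : Fin n, ∑ t, c t * (t.sum (e r) * t.sum (e s)) = 0) (t : Index n) : c t = 0 := by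
  have h2 (i j : Fin n) (hij : i < j) : c (.two i j hij) = 0 := by
    rw [← sum_mul_sum_e_of_lt hc hij, h]
  rcases t with i | ⟨i, j, hij⟩ | ⟨i, j, k, hij, hjk⟩
  · rw [← sum_mul_sum_e_self hc h2 i, h]
  · exact h2 i j hij
  · exact hc ..

theorem eq_zero_of_quadratic {c : Index n → ℂ}
    (hc : ∀ i j k hij hjk, c (.three i j k hij hjk) = 0)
    (h : ∀ P : Fin n → ℂ, ∑ t, c t * t.sum P ^ 2 = 0) (t : Index n) : c t = 0 := by
  refine eq_zero_of_bilinear hc (fun r s => ?_) t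
  have key : 2 * ∑ t, c t * (t.sum (e r) * t.sum (e s)) =
      ∑ t, c t * t.sum (e r + e s) ^ 2 - ∑ t, c t * t.sum (e r) ^ 2
        - ∑ t, c t * t.sum (e s) ^ 2 := by
    simp only [Finset.mul_sum, ← Finset.sum_sub_distrib]
    refine Finset.sum_congr rfl fun t _ => ?_
    rw [Index.sum_add]
    ring
  rw [h, h, h] at key
  simpa using key

/-- The multilinear form attached to a family of coefficients. -/
noncomputable def mixedForm (d : Index n → Index n → ℂ) (P P' P'' Q R : Fin n → ℂ) : ℂ :=
  ∑ s, ∑ r, d s r * (s.sum P * s.sum P' * r.minor P'' Q R)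

theorem mixedForm_relation {d : Index n → Index n → ℂ}
    (h : ∀ P Q R : Fin n → ℂ, ∑ s, ∑ r, d s r * (s.quad P Q R * r.minor P Q R) = 0)
    (x y z Q R : Fin n → ℂ) :
    mixedForm d x y z Q R + mixedForm d x z y Q R + mixedForm d y z x Q R = 0 := by
  -- Since `quad` is `P² + QR`, the hypothesis has parts of degree 3 and 1 in `P`; comparing `P`
  -- with `2P` separates them. The cubic part is then polarized.
  have h1 (P Q R : Fin n → ℂ) : mixedForm d P P P Q R = 0 := by
    have e1 : ∑ s, ∑ r, d s r * (s.quad P Q R * r.minor P Q R) =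
        mixedForm d P P P Q R + mixedForm d Q R P Q R := by
      simp only [mixedForm, ← Finset.sum_add_distrib, Index.quad]
      exact Finset.sum_congr rfl fun s _ => Finset.sum_congr rfl fun r _ => by ring
    have e2 : ∑ s, ∑ r, d s r * (s.quad ((2 : ℂ) • P) Q R * r.minor ((2 : ℂ) • P) Q R) =
        8 * mixedForm d P P P Q R + 2 * mixedForm d Q R P Q R := by
      simp only [mixedForm, Finset.mul_sum, ← Finset.sum_add_distrib, Index.quad, Index.sum_smul,
        Index.minor_smul]
      exact Finset.sum_congr rfl fun s _ => Finset.sum_congr rfl fun r _ => by ring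
    rw [h] at e1 e2
    linear_combination (1 / 3) * e1 - (1 / 6) * e2
  have key : 2 * (mixedForm d x y z Q R + mixedForm d x z y Q R + mixedForm d y z x Q R) =
      mixedForm d (x + y + z) (x + y + z) (x + y + z) Q R - mixedForm d (x + y) (x + y) (x + y) Q R
        - mixedForm d (x + z) (x + z) (x + z) Q R - mixedForm d (y + z) (y + z) (y + z) Q R
        + mixedForm d x x x Q R + mixedForm d y y y Q R + mixedForm d z z z Q R := by
    simp only [mixedForm, Finset.mul_sum, ← Finset.sum_add_distrib, ← Finset.sum_sub_distrib,
      Index.sum_add, Index.minor_add]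
    exact Finset.sum_congr rfl fun s _ => Finset.sum_congr rfl fun r _ => by ring
  simp only [h1] at key
  simpa using key

theorem mixedForm_e {d : Index n → Index n → ℂ} (r s : Fin n) {a b c : Fin n} (hab : a < b)
    (hbc : b < c) : mixedForm d (e r) (e s) (e a) (e b) (e c) =
      ∑ t, d t (.three a b c hab hbc) * (t.sum (e r) * t.sum (e s)) := by
  refine Finset.sum_congr rfl fun t _ => ?_
  rw [Finset.sum_eq_single (.three a b c hab hbc)]
  · rw [Index.minor_e_self, mul_one]
  · intro t' _ ht
    rw [Index.minor_e_of_ne hab hbc ht, mul_zero, mul_zero]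
  · simp

/-- Coefficients supported on `S` that annihilate the leading terms of the products `t' t'`
vanish. -/
theorem coeff_eq_zero {d : Index n → Index n → ℂ} (hsymm : ∀ s r, d s r = d r s)
    (hS : ∀ s r, t' s * t' r ∉ S n → d s r = 0)
    (h1 : ∀ P Q R : Fin n → ℂ, ∑ s, ∑ r, d s r * (s.quad P Q R * r.quad P Q R) = 0)
    (h2 : ∀ P Q R : Fin n → ℂ, ∑ s, ∑ r, d s r * (s.quad P Q R * r.minor P Q R) = 0)
    (s r : Index n) : d s r = 0 := by
  have h33 (a b c : Fin n) (hab hbc) (i j k : Fin n) (hij hjk) :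
      d (.three i j k hij hjk) (.three a b c hab hbc) = 0 :=
    hS _ _ (t₃_mul_t₃_not_mem_S hij hjk hab hbc)
  have hD := eq_zero_of_excluded (D := fun r s a b c => mixedForm d (e r) (e s) (e a) (e b) (e c))
    (fun r s a b c => by
      exact Finset.sum_congr rfl fun _ _ => Finset.sum_congr rfl fun _ _ => by ring)
    (fun r s a b c => by
      simp only [mixedForm, ← Finset.sum_neg_distrib]
      refine Finset.sum_congr rfl fun _ _ => Finset.sum_congr rfl fun _ _ => ?_
      rw [Index.minor_swap₁₂]
      ring)
    (fun r s a b c => by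
      simp only [mixedForm, ← Finset.sum_neg_distrib]
      refine Finset.sum_congr rfl fun _ _ => Finset.sum_congr rfl fun _ _ => ?_
      rw [Index.minor_swap₂₃]
      ring)
    (fun i j k b c => mixedForm_relation h2 _ _ _ _ _)
    (fun p q a b c hpq hab hbc hex => by
      rw [mixedForm_e p q hab hbc, sum_mul_sum_e_of_lt (h33 a b c hab hbc) hpq]
      exact hS _ _ (t₂_mul_t₃_not_mem_S hpq hab hbc hex))
  have h3 (s : Index n) (a b c : Fin n) (hab hbc) : d s (.three a b c hab hbc) = 0 := by
    refine eq_zero_of_bilinear (c := fun t => d t (.three a b c hab hbc)) (h33 a b c hab hbc) ?_ s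
    intro r s
    rw [← mixedForm_e r s hab hbc]
    exact hD r s a b c
  have h4 (P Q : Fin n → ℂ) : ∑ s, ∑ r, d s r * (s.sum P ^ 2 * r.sum Q ^ 2) = 0 := by
    have hP (P : Fin n → ℂ) : ∑ s, ∑ r, d s r * (s.sum P ^ 2 * r.sum P ^ 2) = 0 := by
      simpa [Index.quad, Index.sum_zero] using h1 P 0 0
    have hswap : ∑ s, ∑ r, d s r * (s.sum Q ^ 2 * r.sum P ^ 2) =
        ∑ s, ∑ r, d s r * (s.sum P ^ 2 * r.sum Q ^ 2) := by
      rw [Finset.sum_comm]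
      refine Finset.sum_congr rfl fun s _ => Finset.sum_congr rfl fun r _ => ?_
      rw [hsymm]
      ring
    -- For `R = Q` the form `quad` is a sum of two squares; the mixed terms separate the two
    -- factors.
    have key : ∑ s, ∑ r, d s r * (s.quad P Q Q * r.quad P Q Q) =
        ∑ s, ∑ r, d s r * (s.sum P ^ 2 * r.sum P ^ 2)
          + ∑ s, ∑ r, d s r * (s.sum P ^ 2 * r.sum Q ^ 2)
          + ∑ s, ∑ r, d s r * (s.sum Q ^ 2 * r.sum P ^ 2)
          + ∑ s, ∑ r, d s r * (s.sum Q ^ 2 * r.sum Q ^ 2) := by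
      simp only [← Finset.sum_add_distrib, Index.quad]
      exact Finset.sum_congr rfl fun s _ => Finset.sum_congr rfl fun r _ => by ring
    rw [h1, hP, hP, hswap] at key
    linear_combination (-1 / 2) * key
  have h5 (Q : Fin n → ℂ) (s : Index n) : ∑ r, d s r * r.sum Q ^ 2 = 0 := by
    refine eq_zero_of_quadratic (c := fun s => ∑ r, d s r * r.sum Q ^ 2) ?_ ?_ s
    · intro i j k hij hjk
      refine Finset.sum_eq_zero fun r _ => ?_
      rw [hsymm, h3, zero_mul]
    · intro P
      rw [← h4 P Q]
      refine Finset.sum_congr rfl fun s _ => ?_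
      rw [Finset.sum_mul]
      exact Finset.sum_congr rfl fun r _ => by ring
  exact eq_zero_of_quadratic (h3 s) (fun Q => h5 Q s) r

end Forms

/-! ### Assembling the bases -/

section Main

variable {n : ℕ}

/-- The cubic term at basis vectors isolates the coefficients of triples; the quadratic term with `Q
= R = 0` gives the others. -/
theorem linear_eq_zero {a : ℚ} {c : Index n → ℚ}
    (h : C a + ∑ s, C (c s) * t' s ∈
      J₀ n ^ 2 ⊔ IQ (FreeGroup.of : Fin n → FreeGroup (Fin n))) : a = 0 ∧ ∀ s, c s = 0 := by
  have hx := linear_expansion h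
  have h3 (i j k : Fin n) (hij hjk) : (c (.three i j k hij hjk) : ℂ) = 0 := by
    have := (hx (e i) (e j) (e k)).2.2
    rw [Finset.sum_eq_single (.three i j k hij hjk)] at this
    · rwa [Index.minor_e_self, mul_one] at this
    · intro s _ hs
      rw [Index.minor_e_of_ne hij hjk hs, mul_zero]
    · simp
  refine ⟨(hx 0 0 0).1, fun s => ?_⟩
  have := eq_zero_of_quadratic (c := fun s => (c s : ℂ)) h3
    (fun P => by simpa [Index.quad, Index.sum_zero] using (hx P 0 0).2.1) s
  exact_mod_cast this

/-- Modulo `J₀²` an element of `I_ℚ` is a constant plus a linear combination of the `t'`, and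
`linear_eq_zero` kills both. -/
theorem IQ_le_J₀_sq : IQ (FreeGroup.of : Fin n → FreeGroup (Fin n)) ≤ J₀ n ^ 2 := by
  intro p hp
  obtain ⟨a, ha⟩ := exists_sub_C_mem_J₀ p
  have h := span_le_span_rat_sup (Set.range t') (J₀_eq_span n ▸ ha)
  rw [← J₀_eq_span, ← pow_two] at h
  obtain ⟨y, hy, z, hz, hyz⟩ := Submodule.mem_sup.1 h
  obtain ⟨c, rfl⟩ := (Submodule.mem_span_range_iff_exists_fun ℚ).1 hy
  simp only [MvPolynomial.smul_eq_C_mul] at hyz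
  have hpz : C a + ∑ s, C (c s) * t' s = p - z := by linear_combination hyz
  have hmem : C a + ∑ s, C (c s) * t' s ∈
      J₀ n ^ 2 ⊔ IQ (FreeGroup.of : Fin n → FreeGroup (Fin n)) := by
    rw [hpz]
    exact sub_mem (Ideal.mem_sup_right hp) (Ideal.mem_sup_left hz)
  obtain ⟨h0, hc⟩ := linear_eq_zero hmem
  simp only [h0, hc, map_zero, zero_mul, Finset.sum_const_zero, add_zero] at hpz
  rw [sub_eq_zero.1 hpz.symm]
  exact hz

theorem isGrBasis_T : IsGrBasis (FreeGroup.of : Fin n → FreeGroup (Fin n)) 1 (T n) := by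
  refine isGrBasis_of _ 1 _ ?_ ?_ ?_
  · intro p hp
    rw [pow_one]
    exact Ideal.subset_span hp
  · intro p hp
    rw [pow_one] at hp
    have h := span_le_span_rat_sup (T n) hp
    obtain ⟨y, hy, z, hz, rfl⟩ := Submodule.mem_sup.1 h
    refine add_mem (Submodule.mem_sup_left hy)
      (Submodule.mem_sup_right (Ideal.mem_sup_left ?_))
    rw [pow_succ, pow_one]
    exact hz
  · intro c hc
    let f : T n ≃ Index n :=
      ((Equiv.ofInjective t' t'_injective).trans (Equiv.setCongr (T_eq_range n).symm)).symm
    have hf (s : Index n) : ((f.symm s : T n) : Poly n) = t' s := rfl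
    have e : C 0 + ∑ s, C (c (f.symm s)) * t' s = c.sum fun p a => a • (p : Poly n) := by
      have : Fintype (T n) := Fintype.ofEquiv _ f.symm
      rw [c.sum_fintype _ (by simp), map_zero, zero_add, ← f.symm.sum_comp]
      exact Finset.sum_congr rfl fun s _ => by rw [hf, MvPolynomial.smul_eq_C_mul]
    rw [← e] at hc
    ext p
    simpa using (linear_eq_zero hc).2 (f p)

/-- Only the symmetrized coefficients are determined, because `t' s * t' r` does not see the order
of the factors. -/
theorem quadratic_eq_zero {c : Index n → Index n → ℚ}
    (hS : ∀ s r, t' s * t' r ∉ S n → c s r = 0)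
    (h : ∑ s, ∑ r, C (c s r) * (t' s * t' r) ∈
      J₀ n ^ 3 ⊔ IQ (FreeGroup.of : Fin n → FreeGroup (Fin n))) (s r : Index n) :
    c s r + c r s = 0 := by
  have hx := quadratic_expansion h
  let d (s r : Index n) : ℂ := c s r + c r s
  have hd : d s r = 0 := by
    refine coeff_eq_zero (d := d) (fun s r => add_comm _ _) ?_ ?_ ?_ s r
    · intro s r hsr
      simp only [d]
      rw [hS s r hsr, hS r s (by rwa [mul_comm])]
      simp
    · intro P Q R
      have e : ∑ s, ∑ r, (c r s : ℂ) * (s.quad P Q R * r.quad P Q R) =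
          ∑ s, ∑ r, (c s r : ℂ) * (s.quad P Q R * r.quad P Q R) := by
        rw [Finset.sum_comm]
        exact Finset.sum_congr rfl fun s _ => Finset.sum_congr rfl fun r _ => by ring
      simp only [d, add_mul, Finset.sum_add_distrib]
      rw [e, (hx P Q R).1, add_zero]
    · intro P Q R
      have e : ∑ s, ∑ r, (c r s : ℂ) * (s.quad P Q R * r.minor P Q R) =
          ∑ s, ∑ r, (c s r : ℂ) * (s.minor P Q R * r.quad P Q R) := by
        rw [Finset.sum_comm]
        exact Finset.sum_congr rfl fun s _ => Finset.sum_congr rfl fun r _ => by ring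
      rw [← (hx P Q R).2]
      simp only [d, add_mul, mul_add, Finset.sum_add_distrib]
      rw [e]
  simp only [d] at hd
  exact_mod_cast hd

theorem isGrBasis_S : IsGrBasis (FreeGroup.of : Fin n → FreeGroup (Fin n)) 2 (S n) := by
  refine isGrBasis_of _ 2 _ ?_ (fun p hp => J₀_sq_le_spanS _ hp) ?_
  · intro p hp
    obtain ⟨s, r, rfl⟩ := S_subset hp
    rw [pow_two]
    exact Ideal.mul_mem_mul (t'_mem_J₀ _) (t'_mem_J₀ _)
  · intro c hc
    choose f g hfg using fun p : S n => S_subset p.2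
    let m (p : S n) : Index n × Index n := (f p, g p)
    have hm : Function.Injective m := by
      intro p p' h
      obtain ⟨h1, h2⟩ := Prod.mk.inj h
      exact Subtype.ext (by rw [hfg p, hfg p', h1, h2])
    have hsum : ∑ s, ∑ r, C (c.mapDomain m (s, r)) * (t' s * t' r) =
        c.sum fun p a => a • (p : Poly n) := by
      rw [← Fintype.sum_prod_type' (fun s r => C (c.mapDomain m (s, r)) * (t' s * t' r))]
      have e1 : (c.mapDomain m).sum (fun u a => C a * (t' u.1 * t' u.2)) =
          c.sum fun p a => a • (p : Poly n) := by
        rw [Finsupp.sum_mapDomain_index (by simp) (by intros; rw [C_add, add_mul])]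
        refine Finsupp.sum_congr fun p _ => ?_
        rw [MvPolynomial.smul_eq_C_mul, hfg p]
      rw [← e1, Finsupp.sum_fintype _ _ (by simp)]
    rw [← hsum] at hc
    have hz := quadratic_eq_zero (c := fun s r => c.mapDomain m (s, r)) (by
      intro s r hsr
      refine Finsupp.mapDomain_of_notMem_range _ _ ?_
      rintro ⟨p, hp⟩
      obtain ⟨rfl, rfl⟩ := Prod.mk.inj hp
      exact hsr (hfg p ▸ p.2)) hc
    ext p
    have hp : c.mapDomain m (f p, g p) = c p := Finsupp.mapDomain_apply hm c p
    have := hz (f p) (g p)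
    rw [hp] at this
    -- The reversed pair is a chosen factorization only for a square, where the sum is `2 c p`;
    -- otherwise its coefficient is 0.
    by_cases hr : (g p, f p) ∈ Set.range m
    · obtain ⟨p', hp'⟩ := hr
      obtain ⟨h1, h2⟩ := Prod.mk.inj hp'
      have hpp : p' = p := Subtype.ext (by rw [hfg p', hfg p, h1, h2, mul_comm])
      rw [← hp', Finsupp.mapDomain_apply hm, hpp] at this
      simpa using this
    · rw [Finsupp.mapDomain_of_notMem_range _ _ hr] at this
      simpa using this

end Main

end Fricke

theorem mainTheorem1 (n : ℕ) (hn : 2 ≤ n) :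
    Fricke.IQ (FreeGroup.of : Fin n → FreeGroup (Fin n)) ≤ Fricke.J₀ n ^ 2 ∧
    Fricke.IsGrBasis (FreeGroup.of : Fin n → FreeGroup (Fin n)) 1 (Fricke.T n) ∧
    Fricke.IsGrBasis (FreeGroup.of : Fin n → FreeGroup (Fin n)) 2 (Fricke.S n) :=
  ⟨Fricke.IQ_le_J₀_sq, Fricke.isGrBasis_T, Fricke.isGrBasis_S⟩
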